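/- Let $\nu>0$ and $0<f<1$, and put $\underline\Lambda=\sqrt{f(1-f)}$. Consider on $\mathbb R^3\ni\mathbf x=(x,y,z)$ the Navier--Stokes--Coriolis system linearized around the Couette flow $(y,0,0)$, for real fields $\mathbf u=(u_1,u_2,u_3)$ and $q$, $$\partial_t\mathbf u+(u_2,0,0)+y\,\partial_x\mathbf u+f\,(-u_2,u_1,0)=\nu\Delta\mathbf u-\nabla q,\qquad \operatorname{div}\mathbf u=0,$$ $$q=-\Delta^{-1}\bigl(2\partial_xu_2+f(\partial_yu_1-\partial_xu_2)\bigr),\qquad \lim_{|\mathbf x|\to\infty}|\mathbf u(t,\mathbf x)|=0,$$ where $\Delta^{-1}g$ denotes the solution of $\Delta\varphi=g$ that vanishes at infinity. There are constants $C_k>0$ ($k=1,2,\dots$), independent of $T$ and $\epsilon$, such that for every $T>0$ and every $\epsilon>0$ this system has on $[0,T]$ a real-valued classical solution $(\mathbf u,q)$, smooth in $\mathbf x$, with $\mathbf u(0)\neq 0$ and $\mathbf u,\nabla q\in C([0,T];[H^k(\mathbb R^3)]^3)$ for all integers $k\ge 0$, that satisfies: (i) for all $t\in[0,T]$, $$(e^{t\underline\Lambda}-\epsilon)\,\|\mathbf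 u(0)\|_{L^2}\le\|\mathbf u(t)\|_{L^2}\le(e^{t\underline\Lambda}+\epsilon)\,\|\mathbf u(0)\|_{L^2};$$ (ii) for every positive integer $k$, $\ \|\mathbf u(0)\|_{H^k}\le C_k\,k\,\|\mathbf u(0)\|_{L^2}$. -/

import Mathlib

open Filter Topology MeasureTheory Set
open scoped ENNReal ContDiff

/-- Three-dimensional Euclidean space; the coordinates `(x, y, z)` are `(p 0, p 1, p 2)`. -/
abbrev R3 : Type := EuclideanSpace ℝ (Fin 3)

/-- Three-dimensional complex Euclidean space. -/
abbrev C3 : Type := EuclideanSpace ℂ (Fin 3)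

noncomputable section

/-- The partial derivative `∂_i g` of a scalar or vector valued function on `ℝ³`. -/
def partialD {F : Type*} [NormedAddCommGroup F] [NormedSpace ℝ F] (i : Fin 3) (g : R3 → F) :
    R3 → F :=
  fun p => fderiv ℝ g p (EuclideanSpace.single i 1)

/-- The divergence of a vector field on `ℝ³`. -/
def divergence (v : R3 → R3) : R3 → ℝ :=
  fun p => ∑ i : Fin 3, partialD i (fun p' => v p' i) p

/-- A real vector field, regarded as a complex one. -/
def complexify (v : R3 → R3) : R3 → C3 :=
  fun p => WithLp.toLp 2 (fun i => ((v p i : ℝ) : ℂ))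

/-- The `L²` norm of a vector field (used for fields in `L²`). -/
def l2Norm (v : R3 → R3) : ℝ := (eLpNorm v 2 volume).toReal

open Classical in
/-- The Sobolev norm `‖v‖_{H^k} = ‖(1 - Δ)^{k/2} v‖_{L²}` of a vector field, with value `⊤` (infinity) if `v`
is not in `H^k`.  It is the `L²` norm of `(1 + |2πξ|²)^{k/2} v̂(ξ)`, where `v̂` is the `L²`
Fourier (Plancherel) transform with kernel `exp (-2πi x·ξ)`. -/
def sobolevENorm (k : ℕ) (v : R3 → R3) : ℝ≥0∞ :=
  if h : MemLp (complexify v) 2 (volume : Measure R3) then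
    eLpNorm (fun ξ : R3 => (1 + (2 * Real.pi * ‖ξ‖) ^ 2) ^ ((k : ℝ) / 2) •
      (FourierTransform.fourier (h.toLp (complexify v)) : Lp C3 2 (volume : Measure R3)) ξ) 2 volume
  else ⊤

/-- Membership of a vector field in `[H^k(ℝ³)]³`. -/
def MemHk (k : ℕ) (v : R3 → R3) : Prop := sobolevENorm k v < ⊤

/-- The Sobolev norm as a real number (used for fields in `H^k`). -/
def sobolevNorm (k : ℕ) (v : R3 → R3) : ℝ := (sobolevENorm k v).toReal

/-- `w ∈ C([0,T]; [H^k(ℝ³)]³)`. -/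
def ContinuousInHk (k : ℕ) (T : ℝ) (w : ℝ → R3 → R3) : Prop :=
  (∀ t ∈ Icc 0 T, MemHk k (w t)) ∧
  ∀ t ∈ Icc 0 T, Tendsto (fun s => sobolevENorm k (w s - w t)) (𝓝[Icc 0 T] t) (𝓝 0)

/-- `φ = Δ⁻¹ g` on `ℝ³`: the (unique, by the maximum principle) solution of the Poisson equation
`Δ φ = g` that vanishes at infinity. -/
def IsInverseLaplacian (g φ : R3 → ℝ) : Prop :=
  ContDiff ℝ 2 φ ∧ (∀ p, (Laplacian.laplacian φ : R3 → ℝ) p = g p) ∧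
    Tendsto φ (cocompact R3) (𝓝 0)

/-- `2 ∂ₓ v₂ + f (∂_y v₁ - ∂ₓ v₂)`, where `v = (v₁, v₂, v₃)` is `(v 0, v 1, v 2)`. -/
def pressureSource (f : ℝ) (v : R3 → R3) : R3 → ℝ := fun p =>
  2 * partialD 0 (fun p' => v p' 1) p
    + f * (partialD 1 (fun p' => v p' 0) p - partialD 0 (fun p' => v p' 1) p)

/-- The right-hand side of the linearized momentum equation solved for the time derivative,
`ν Δ v - ∇π - (v₂, 0, 0) - y ∂ₓ v - f (-v₂, v₁, 0)`, at the point `p`. -/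
def linearizedRHS (ν f : ℝ) (v : R3 → R3) (π : R3 → ℝ) (p : R3) : R3 :=
  ν • (Laplacian.laplacian v : R3 → R3) p - gradient π p - !₂[v p 1, 0, 0]
    - p 1 • partialD 0 v p - f • !₂[-(v p 1), v p 0, 0]

/-- `(u, q)` is a classical solution on `[0,T] × ℝ³`, in `C([0,T]; H^k)` for every `k`, of the
Navier-Stokes-Coriolis system linearized around the Couette flow `(y, 0, 0)`, vanishing at
spatial infinity.  At the end points of `[0,T]` time derivatives are one-sided. -/
structure IsLinearizedSolution (ν f T : ℝ) (u : ℝ → R3 → R3) (q : ℝ → R3 → ℝ) : Prop where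
  /-- each `u(t)` is smooth in space -/
  smooth : ∀ t ∈ Icc 0 T, ContDiff ℝ ∞ (u t)
  /-- each `q(t)` is smooth in space -/
  smooth_pressure : ∀ t ∈ Icc 0 T, ContDiff ℝ ∞ (q t)
  /-- `u ∈ C([0,T]; H^k)` for all `k` -/
  continuous_velocity : ∀ k : ℕ, ContinuousInHk k T u
  /-- `∇q ∈ C([0,T]; H^k)` for all `k` -/
  continuous_pressure : ∀ k : ℕ, ContinuousInHk k T (fun t => gradient (q t))
  /-- the momentum equation -/
  momentum : ∀ t ∈ Icc 0 T, ∀ p : R3,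
    HasDerivWithinAt (fun s => u s p) (linearizedRHS ν f (u t) (q t) p) (Icc 0 T) t
  /-- `q = -Δ⁻¹ (2 ∂ₓ u₂ + f (∂_y u₁ - ∂ₓ u₂))` -/
  pressure : ∀ t ∈ Icc 0 T, IsInverseLaplacian (pressureSource f (u t)) (fun p => -q t p)
  /-- incompressibility -/
  div_free : ∀ t ∈ Icc 0 T, ∀ p : R3, divergence (u t) p = 0
  /-- the far-field condition -/
  far_field : ∀ t ∈ Icc 0 T, Tendsto (fun p => ‖u t p‖) (cocompact R3) (𝓝 0)

end

/-!
# Exponentially growing solutions of the linearized Navier–Stokes–Coriolis system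

A plane wave `cos (2π ω·x) v` with wave vector `ω = (k, η - k t, l)` that is sheared by the
Couette flow (a Kelvin wave) is an exact solution as soon as its amplitude `v(t)` is orthogonal
to `ω` and solves a linear ordinary differential equation: the transport term `y ∂ₓ` is
cancelled by the motion of `ω`, and the pressure is a Fourier multiplier. For `k = η = ν = 0` the
equation for the planar components is `v₁' = -(1 - f) v₂`, `v₂' = -f v₁`, with growing mode
`exp (t √(f(1-f))) (-√(1-f), √f)`. Fields that do not depend on `x` and `y` have infinite
energy, so the solution is a superposition of Kelvin waves over a small box of wave vectors with
`|k|, |η| ≤ ρ²` and `ρ ≤ |l| ≤ 2ρ`.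

On this box the viscous and pressure terms are `O(ρ²)` (`norm_planarPerturbation_le`), and in
coordinates along the growing and decaying modes the whole family of equations becomes one
equation with small Lipschitz constant in a Banach space of continuous functions of the wave
vector (`exists_parametrized_solution`). This yields amplitudes that are continuous in time and
wave vector and as close to the growing mode as desired on `[0, T]` (`exists_isKelvinFamily`).
The spanwise component, recovered from incompressibility, is `O(ρ)`.

In physical space the time derivative is taken under the integral over the initial wave vectors,
where no derivative of the amplitudes with respect to the wave vector is needed
(`IsKelvinFamily.hasDerivAt_velocity`), and the spatial terms are computed after the volume
preserving change of variables `ξ ↦ ω` (`linearizedRHS_cosField`). Since the densities are even,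
continuous and compactly supported, the Plancherel transforms of the (real) cosine fields are
the densities themselves (`fourierInv_ae_eq_fourierInv_toLp`, `sobolevENorm_cosField`), which
reduces the two norm statements to pointwise statements about the amplitudes. As all initial
wave vectors satisfy `‖2π ξ‖ ≤ 1`, the Sobolev norms of the initial velocity are controlled with
`C k = 2 ^ k`.
-/

/-! ### Fourier integrals of real densities -/

theorem continuous_neg_innerₗ : Continuous fun p : R3 × R3 => (-innerₗ R3) p.1 p.2 := by
  change Continuous fun p : R3 × R3 => -inner ℝ p.1 p.2
  fun_prop

open FourierTransform SchwartzMap in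
/-- The inverse Fourier integral of an integrable and square-integrable function represents its
inverse Plancherel transform: both define the same tempered distribution. -/
theorem fourierInv_ae_eq_fourierInv_toLp {F : Type*} [NormedAddCommGroup F]
    [InnerProductSpace ℂ F] [CompleteSpace F] {g : R3 → F}
    (hg : Integrable g) (hg2 : MemLp g 2 (volume : Measure R3)) :
    𝓕⁻ g =ᵐ[volume] (𝓕⁻ (hg2.toLp g) : Lp F 2 (volume : Measure R3)) := by
  have hcont : Continuous (𝓕⁻ g) := by
    have := VectorFourier.fourierIntegral_continuous (μ := (volume : Measure R3))
      (L := -innerₗ R3) Real.continuous_fourierChar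
      continuous_neg_innerₗ hg
    exact this
  refine ae_eq_of_integral_contDiff_smul_eq hcont.locallyIntegrable
    ((Lp.memLp _).locallyIntegrable (by norm_num)) fun φ hφ hφc => ?_
  have hφ' : ContDiff ℝ ∞ (fun x => (φ x : ℂ)) := Complex.ofRealCLM.contDiff.comp hφ
  have hφc' : HasCompactSupport (fun x => (φ x : ℂ)) := hφc.comp_left Complex.ofReal_zero
  let Φ : 𝓢(R3, ℂ) := hφc'.toSchwartzMap hφ'
  have hΦ : ∀ x, Φ x = (φ x : ℂ) := fun x => rfl
  have h1 := congrArg (fun d : 𝓢'(R3, F) => d Φ)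
    (MeasureTheory.Lp.fourierInv_toTemperedDistribution_eq (hg2.toLp g))
  simp only [TemperedDistribution.fourierInv_apply,
    MeasureTheory.Lp.toTemperedDistribution_apply] at h1
  have h2 : ∫ x, Φ x • (𝓕⁻ g) x = ∫ ξ, (𝓕⁻ Φ) ξ • g ξ := by
    have := VectorFourier.integral_fourierIntegral_smul_eq_flip (μ := (volume : Measure R3))
      (ν := (volume : Measure R3)) (L := -innerₗ R3) (f := Φ) (g := g) Real.continuous_fourierChar
      continuous_neg_innerₗ Φ.integrable hg
    have hflip : (-innerₗ R3).flip = -innerₗ R3 := by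
      ext x y; simp [real_inner_comm]
    rw [hflip] at this
    rw [SchwartzMap.fourierInv_coe]
    exact this.symm
  have h3 : ∫ ξ, (𝓕⁻ Φ) ξ • g ξ = ∫ ξ, (𝓕⁻ Φ) ξ • (hg2.toLp g) ξ := by
    refine integral_congr_ae ?_
    filter_upwards [hg2.coeFn_toLp] with ξ hξ
    rw [hξ]
  have h4 := h2.trans (h3.trans h1)
  simpa [hΦ] using h4

noncomputable section

/-- The cosine transform `x ↦ ∫ cos (2π ξ·x) g(ξ) dξ`. -/
def cosTransform (g : R3 → ℝ) (x : R3) : ℝ := ∫ ξ, Real.cos (2 * Real.pi * inner ℝ ξ x) * g ξ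

/-- The sine transform `x ↦ ∫ sin (2π ξ·x) g(ξ) dξ`. -/
def sinTransform (g : R3 → ℝ) (x : R3) : ℝ := ∫ ξ, Real.sin (2 * Real.pi * inner ℝ ξ x) * g ξ

/-- The cosine transform of a vector field, component by component. -/
def cosField (g : R3 → R3) (x : R3) : R3 := WithLp.toLp 2 fun j => cosTransform (fun ξ => g ξ j) x

theorem integrable_cos_mul {g : R3 → ℝ} (hg : Integrable g) (x : R3) :
    Integrable (fun ξ => Real.cos (2 * Real.pi * inner ℝ ξ x) * g ξ) := by
  refine hg.bdd_mul (c := 1) (by fun_prop) (ae_of_all _ fun ξ => ?_)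
  simpa using Real.abs_cos_le_one _

theorem integrable_sin_mul {g : R3 → ℝ} (hg : Integrable g) (x : R3) :
    Integrable (fun ξ => Real.sin (2 * Real.pi * inner ℝ ξ x) * g ξ) := by
  refine hg.bdd_mul (c := 1) (by fun_prop) (ae_of_all _ fun ξ => ?_)
  simpa using Real.abs_sin_le_one _

open FourierTransform in
theorem fourierInv_ofReal {g : R3 → ℝ} (hg : Integrable g) (x : R3) :
    𝓕⁻ (fun ξ => (g ξ : ℂ)) x = cosTransform g x + sinTransform g x * Complex.I := by
  rw [Real.fourierInv_eq']
  have h1 : ∀ ξ : R3, Complex.exp (((2 * Real.pi * inner ℝ ξ x : ℝ) : ℂ) * Complex.I) • (g ξ : ℂ)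
      = ((Real.cos (2 * Real.pi * inner ℝ ξ x) * g ξ : ℝ) : ℂ)
        + ((Real.sin (2 * Real.pi * inner ℝ ξ x) * g ξ : ℝ) : ℂ) * Complex.I := fun ξ => by
    rw [Complex.exp_mul_I, smul_eq_mul]; push_cast; ring
  simp_rw [h1]
  rw [integral_add (integrable_cos_mul hg x).ofReal
    ((integrable_sin_mul hg x).ofReal.mul_const _), integral_mul_const,
    integral_complex_ofReal, integral_complex_ofReal]
  rfl

open FourierTransform in
theorem fourier_ofReal {g : R3 → ℝ} (hg : Integrable g) (x : R3) :
    𝓕 (fun ξ => (g ξ : ℂ)) x = cosTransform g x - sinTransform g x * Complex.I := by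
  have h := fourierInv_ofReal hg (-x)
  rw [Real.fourierInv_eq_fourier_neg, neg_neg] at h
  rw [h]
  simp [cosTransform, sinTransform, integral_neg, sub_eq_add_neg]

theorem cosTransform_eq_re {g : R3 → ℝ} (hg : Integrable g) :
    cosTransform g = fun x => (FourierTransform.fourier (fun ξ => (g ξ : ℂ)) x : ℂ).re := by
  ext x; rw [fourier_ofReal hg]; simp

theorem sinTransform_eq_neg_im {g : R3 → ℝ} (hg : Integrable g) :
    sinTransform g = fun x => -(FourierTransform.fourier (fun ξ => (g ξ : ℂ)) x : ℂ).im := by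
  ext x; rw [fourier_ofReal hg]; simp

theorem contDiff_fourier_ofReal {g : R3 → ℝ} (hg : Continuous g) (hc : HasCompactSupport g) :
    ContDiff ℝ ∞ (FourierTransform.fourier (fun ξ => (g ξ : ℂ)) : R3 → ℂ) := by
  refine Real.contDiff_fourier fun n _ => ?_
  refine Continuous.integrable_of_hasCompactSupport (by fun_prop) ?_
  have : HasCompactSupport (fun v => ‖(g v : ℂ)‖) :=
    hc.comp_left (g := fun y : ℝ => ‖(y : ℂ)‖) (by simp)
  exact this.mul_left

theorem contDiff_cosTransform {g : R3 → ℝ} (hg : Continuous g) (hc : HasCompactSupport g) :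
    ContDiff ℝ ∞ (cosTransform g) := by
  rw [cosTransform_eq_re (hg.integrable_of_hasCompactSupport hc)]
  exact Complex.reCLM.contDiff.comp (contDiff_fourier_ofReal hg hc)

theorem contDiff_sinTransform {g : R3 → ℝ} (hg : Continuous g) (hc : HasCompactSupport g) :
    ContDiff ℝ ∞ (sinTransform g) := by
  rw [sinTransform_eq_neg_im (hg.integrable_of_hasCompactSupport hc)]
  exact (Complex.imCLM.contDiff.comp (contDiff_fourier_ofReal hg hc)).neg

/-- Riemann–Lebesgue for the Fourier integral of a real density. -/
theorem tendsto_fourier_ofReal (g : R3 → ℝ) :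
    Tendsto (FourierTransform.fourier (fun ξ => (g ξ : ℂ)) : R3 → ℂ) (cocompact R3) (𝓝 0) := by
  exact tendsto_integral_exp_inner_smul_cocompact (fun ξ : R3 => (g ξ : ℂ))

theorem tendsto_cosTransform {g : R3 → ℝ} (hg : Integrable g) :
    Tendsto (cosTransform g) (cocompact R3) (𝓝 0) := by
  rw [cosTransform_eq_re hg]
  exact (Complex.continuous_re.tendsto' 0 0 rfl).comp (tendsto_fourier_ofReal g)

theorem tendsto_sinTransform {g : R3 → ℝ} (hg : Integrable g) :
    Tendsto (sinTransform g) (cocompact R3) (𝓝 0) := by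
  rw [sinTransform_eq_neg_im hg]
  have h := ((Complex.continuous_im.tendsto' 0 0 rfl).comp (tendsto_fourier_ofReal g)).neg
  rwa [neg_zero] at h

open FourierTransform in
theorem fderiv_fourier_ofReal {g : R3 → ℝ} (hg : Continuous g) (hc : HasCompactSupport g)
    (x : R3) (i : Fin 3) :
    fderiv ℝ (𝓕 (fun ξ => (g ξ : ℂ))) x (EuclideanSpace.single i 1)
      = -Complex.I * (cosTransform (fun ξ => 2 * Real.pi * ξ i * g ξ) x
        - sinTransform (fun ξ => 2 * Real.pi * ξ i * g ξ) x * Complex.I) := by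
  have hcC : HasCompactSupport (fun ξ => (g ξ : ℂ)) := hc.comp_left Complex.ofReal_zero
  have hi : Integrable (fun ξ => (g ξ : ℂ)) :=
    Continuous.integrable_of_hasCompactSupport (by fun_prop) hcC
  have hi1 : Integrable (fun v => ‖v‖ * ‖(g v : ℂ)‖) := by
    refine Continuous.integrable_of_hasCompactSupport (by fun_prop) ?_
    have : HasCompactSupport (fun v => ‖(g v : ℂ)‖) :=
      hc.comp_left (g := fun y : ℝ => ‖(y : ℂ)‖) (by simp)
    exact this.mul_left
  have hm : Integrable (fun ξ : R3 => 2 * Real.pi * ξ i * g ξ) :=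
    Continuous.integrable_of_hasCompactSupport (by fun_prop) hc.mul_left
  rw [Real.fderiv_fourier hi hi1, ← fourier_ofReal hm]
  have hsm : Integrable (VectorFourier.fourierSMulRight (innerSL ℝ) (fun ξ : R3 => (g ξ : ℂ))) := by
    refine Continuous.integrable_of_hasCompactSupport ?_ ?_
    · unfold VectorFourier.fourierSMulRight; fun_prop
    · refine hcC.mono fun ξ hξ hz => hξ ?_
      simp only at hz
      ext v
      simp [VectorFourier.fourierSMulRight_apply, hz]
  refine (Real.fourierIntegral_continuousLinearMap_apply' (L := innerSL ℝ) hsm).trans ?_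
  simp only [VectorFourier.fourierSMulRight_apply]
  rw [Real.fourier_eq, ← integral_const_mul]
  refine integral_congr_ae (ae_of_all _ fun ξ => ?_)
  have e1 : (innerSL ℝ ξ) (EuclideanSpace.single i 1) = ξ i := by
    simp [EuclideanSpace.inner_single_right]
  have e2 : (innerSL ℝ).toLinearMap₁₂ ξ x = inner ℝ ξ x := rfl
  simp only [Circle.smul_def, smul_eq_mul, e1, e2, Complex.real_smul]
  push_cast
  ring

theorem partialD_cosTransform {g : R3 → ℝ} (hg : Continuous g) (hc : HasCompactSupport g)
    (i : Fin 3) :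
    partialD i (cosTransform g) = sinTransform (fun ξ => -(2 * Real.pi * ξ i) * g ξ) := by
  ext x
  have hd := ((contDiff_fourier_ofReal hg hc).differentiable (by simp)).differentiableAt (x := x)
  rw [cosTransform_eq_re (hg.integrable_of_hasCompactSupport hc)]
  have h := (Complex.reCLM.hasFDerivAt.comp x hd.hasFDerivAt).fderiv
  have e : partialD i (fun x => (FourierTransform.fourier (fun ξ => (g ξ : ℂ)) x : ℂ).re) x
      = (fderiv ℝ (FourierTransform.fourier (fun ξ => (g ξ : ℂ)) : R3 → ℂ) x
          (EuclideanSpace.single i 1)).re := by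
    unfold partialD
    exact congrArg (fun T => T (EuclideanSpace.single i 1)) h
  rw [e, fderiv_fourier_ofReal hg hc]
  simp [sinTransform, integral_neg]

theorem partialD_sinTransform {g : R3 → ℝ} (hg : Continuous g) (hc : HasCompactSupport g)
    (i : Fin 3) :
    partialD i (sinTransform g) = cosTransform (fun ξ => 2 * Real.pi * ξ i * g ξ) := by
  ext x
  have hd := ((contDiff_fourier_ofReal hg hc).differentiable (by simp)).differentiableAt (x := x)
  rw [sinTransform_eq_neg_im (hg.integrable_of_hasCompactSupport hc)]
  have h := (Complex.imCLM.hasFDerivAt.comp x hd.hasFDerivAt).neg.fderiv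
  have e : partialD i (fun x => -(FourierTransform.fourier (fun ξ => (g ξ : ℂ)) x : ℂ).im) x
      = -(fderiv ℝ (FourierTransform.fourier (fun ξ => (g ξ : ℂ)) : R3 → ℂ) x
          (EuclideanSpace.single i 1)).im := by
    unfold partialD
    exact congrArg (fun T => T (EuclideanSpace.single i 1)) h
  rw [e, fderiv_fourier_ofReal hg hc]
  simp

end

/-! ### Fields with even densities: Plancherel, Sobolev norms and derivatives -/

noncomputable section

theorem hasCompactSupport_of_zero {E F : Type*} [Zero E] [Zero F] {g : R3 → E} {h : R3 → F}
    (hg : HasCompactSupport g) (H : ∀ ξ, g ξ = 0 → h ξ = 0) : HasCompactSupport h :=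
  hg.mono fun ξ hξ hz => hξ (H ξ hz)

/-- Continuous, compactly supported, even densities: those whose cosine transform is the inverse
Fourier transform and is a smooth square-integrable field. -/
structure IsEvenDensity (g : R3 → R3) : Prop where
  continuous : Continuous g
  compact : HasCompactSupport g
  even : ∀ ξ, g (-ξ) = g ξ

namespace IsEvenDensity

variable {g h : R3 → R3}

theorem continuous_apply (hg : IsEvenDensity g) (j : Fin 3) : Continuous fun ξ => g ξ j := by
  have := hg.continuous
  fun_prop

theorem compact_apply (hg : IsEvenDensity g) (j : Fin 3) : HasCompactSupport fun ξ => g ξ j :=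
  hg.compact.comp_left (g := fun v : R3 => v j) (by simp)

theorem integrable_apply (hg : IsEvenDensity g) (j : Fin 3) : Integrable fun ξ => g ξ j :=
  (hg.continuous_apply j).integrable_of_hasCompactSupport (hg.compact_apply j)

theorem sub (hg : IsEvenDensity g) (hh : IsEvenDensity h) : IsEvenDensity fun ξ => g ξ - h ξ where
  continuous := hg.continuous.sub hh.continuous
  compact := hg.compact.sub hh.compact
  even ξ := by rw [hg.even, hh.even]

end IsEvenDensity

theorem sinTransform_eq_zero {g : R3 → ℝ} (hg : ∀ ξ, g (-ξ) = g ξ) (x : R3) :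
    sinTransform g x = 0 := by
  have h : sinTransform g x = -sinTransform g x := by
    conv_lhs => rw [sinTransform, ← integral_neg_eq_self]
    simp [sinTransform, hg, integral_neg]
  linarith

theorem continuous_complexify {g : R3 → R3} (hg : Continuous g) : Continuous (complexify g) := by
  unfold complexify
  fun_prop

theorem norm_complexify (g : R3 → R3) (x : R3) : ‖complexify g x‖ = ‖g x‖ := by
  simp [complexify, EuclideanSpace.norm_eq]

theorem compact_complexify {g : R3 → R3} (hg : HasCompactSupport g) :
    HasCompactSupport (complexify g) := by
  refine hasCompactSupport_of_zero hg fun x hz => ?_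
  rw [← norm_eq_zero, norm_complexify, hz, norm_zero]

variable {g h : R3 → R3}

open FourierTransform in
theorem complexify_cosField (hg : IsEvenDensity g) :
    complexify (cosField g) = 𝓕⁻ (complexify g) := by
  ext x j
  have hi : Integrable (fun ξ => Complex.exp (((2 * Real.pi * inner ℝ ξ x : ℝ) : ℂ) * Complex.I) •
      complexify g ξ) := by
    have := continuous_complexify hg.continuous
    refine Continuous.integrable_of_hasCompactSupport (by fun_prop)
      (hasCompactSupport_of_zero (compact_complexify hg.compact) fun ξ hξ => ?_)
    rw [hξ, smul_zero]
  have h1 : (𝓕⁻ (complexify g) x) j = 𝓕⁻ (fun ξ => ((g ξ j : ℝ) : ℂ)) x := by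
    rw [Real.fourierInv_eq', Real.fourierInv_eq']
    exact ((EuclideanSpace.proj (𝕜 := ℂ) j).integral_comp_comm hi).symm
  rw [h1, fourierInv_ofReal (hg.integrable_apply j),
    sinTransform_eq_zero (fun ξ => by rw [hg.even])]
  simp [complexify, cosField]

theorem memLp_complexify (hg : IsEvenDensity g) :
    MemLp (complexify g) 2 (volume : Measure R3) :=
  (continuous_complexify hg.continuous).memLp_of_hasCompactSupport (compact_complexify hg.compact)

open FourierTransform in
theorem complexify_cosField_ae_eq (hg : IsEvenDensity g) :
    complexify (cosField g) =ᵐ[volume]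
      (𝓕⁻ ((memLp_complexify hg).toLp _) : Lp C3 2 (volume : Measure R3)) := by
  rw [complexify_cosField hg]
  exact fourierInv_ae_eq_fourierInv_toLp ((continuous_complexify
    hg.continuous).integrable_of_hasCompactSupport (compact_complexify hg.compact)) _

theorem memLp_complexify_cosField (hg : IsEvenDensity g) :
    MemLp (complexify (cosField g)) 2 (volume : Measure R3) :=
  (Lp.memLp _).ae_eq (complexify_cosField_ae_eq hg).symm

open FourierTransform in
theorem fourier_toLp_complexify_cosField (hg : IsEvenDensity g)
    (h : MemLp (complexify (cosField g)) 2 (volume : Measure R3)) :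
    (𝓕 (h.toLp _) : Lp C3 2 (volume : Measure R3)) = (memLp_complexify hg).toLp _ := by
  have : h.toLp _ = (𝓕⁻ ((memLp_complexify hg).toLp _) : Lp C3 2 (volume : Measure R3)) := by
    refine Lp.ext (h.coeFn_toLp.trans (complexify_cosField_ae_eq hg))
  rw [this, fourier_fourierInv_eq]

/-- The Sobolev norm of a cosine field is the weighted `L²` norm of its density. -/
theorem sobolevENorm_cosField (k : ℕ) (hg : IsEvenDensity g) :
    sobolevENorm k (cosField g) =
      eLpNorm (fun ξ : R3 => (1 + (2 * Real.pi * ‖ξ‖) ^ 2) ^ ((k : ℝ) / 2) • g ξ) 2 volume := by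
  rw [sobolevENorm, dif_pos (memLp_complexify_cosField hg), fourier_toLp_complexify_cosField hg]
  refine eLpNorm_congr_norm_ae ?_
  filter_upwards [(memLp_complexify hg).coeFn_toLp] with ξ hξ
  rw [hξ, norm_smul, norm_smul, norm_complexify]

/-- Plancherel for cosine fields. -/
theorem eLpNorm_cosField (hg : IsEvenDensity g) :
    eLpNorm (cosField g) 2 (volume : Measure R3) = eLpNorm g 2 volume := by
  have h1 : eLpNorm (cosField g) 2 (volume : Measure R3) =
      eLpNorm (complexify (cosField g)) 2 volume :=
    eLpNorm_congr_norm_ae (ae_of_all _ fun x => (norm_complexify _ x).symm)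
  have h2 : eLpNorm g 2 (volume : Measure R3) = eLpNorm (complexify g) 2 volume :=
    eLpNorm_congr_norm_ae (ae_of_all _ fun x => (norm_complexify _ x).symm)
  have h := memLp_complexify_cosField hg
  have h3 := MeasureTheory.Lp.norm_fourier_eq (h.toLp _)
  rw [fourier_toLp_complexify_cosField hg, Lp.norm_toLp, Lp.norm_toLp,
    ENNReal.toReal_eq_toReal_iff' (memLp_complexify hg).eLpNorm_ne_top h.eLpNorm_ne_top] at h3
  rw [h1, h2, h3]

theorem cosField_sub (hg : IsEvenDensity g) (hh : IsEvenDensity h) :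
    cosField g - cosField h = cosField (fun ξ => g ξ - h ξ) := by
  ext x j
  simp only [Pi.sub_apply, PiLp.sub_apply, cosField, cosTransform, mul_sub]
  rw [integral_sub (integrable_cos_mul (hg.integrable_apply j) x)
    (integrable_cos_mul (hh.integrable_apply j) x)]

theorem continuous_sobolevWeight (k : ℕ) :
    Continuous fun ξ : R3 => (1 + (2 * Real.pi * ‖ξ‖) ^ 2) ^ ((k : ℝ) / 2) := by
  refine Continuous.rpow_const (by fun_prop) fun ξ => Or.inl ?_
  positivity

theorem memHk_cosField (k : ℕ) (hg : IsEvenDensity g) : MemHk k (cosField g) := by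
  rw [MemHk, sobolevENorm_cosField k hg]
  refine MemLp.eLpNorm_lt_top (Continuous.memLp_of_hasCompactSupport
    ((continuous_sobolevWeight k).smul hg.continuous)
    (hasCompactSupport_of_zero hg.compact fun ξ hξ => ?_))
  rw [hξ, smul_zero]

/-- Cosine fields whose densities depend continuously on time and live in one compact set form
continuous curves in every Sobolev space. -/
theorem continuousInHk_cosField (k : ℕ) (T : ℝ) {K : Set R3} (hK : IsCompact K)
    {g : ℝ → R3 → R3} (hcont : Continuous fun z : ℝ × R3 => g z.1 z.2)
    (hsupp : ∀ t ∈ Icc 0 T, ∀ ξ, ξ ∉ K → g t ξ = 0)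
    (hg : ∀ t ∈ Icc 0 T, IsEvenDensity (g t)) :
    ContinuousInHk k T fun t => cosField (g t) := by
  refine ⟨fun t ht => memHk_cosField k (hg t ht), fun t ht => ?_⟩
  rw [ENNReal.tendsto_nhds_zero]
  intro ε hε
  set F : ℝ → R3 → R3 := fun s ξ =>
    (1 + (2 * Real.pi * ‖ξ‖) ^ 2) ^ ((k : ℝ) / 2) • (g s ξ - g t ξ) with hF
  have hFc : Continuous fun z : ℝ × R3 => F z.1 z.2 := by
    refine ((continuous_sobolevWeight k).comp continuous_snd).smul (hcont.sub ?_)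
    exact hcont.comp (by fun_prop : Continuous fun z : ℝ × R3 => (t, z.2))
  -- a bound on the integrand that makes the `L²` norm over `K` at most `ε`
  obtain ⟨c, hc0, hc⟩ : ∃ c : ℝ, 0 < c ∧
      volume K ^ (2 : ℝ≥0∞).toReal⁻¹ * ENNReal.ofReal c ≤ ε := by
    have hV : volume K ^ (2 : ℝ≥0∞).toReal⁻¹ ≠ ⊤ :=
      ENNReal.rpow_ne_top_of_nonneg (inv_nonneg.2 ENNReal.toReal_nonneg) hK.measure_lt_top.ne
    have h : Tendsto (fun c : ℝ => volume K ^ (2 : ℝ≥0∞).toReal⁻¹ * ENNReal.ofReal c) (𝓝[>] 0)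
        (𝓝 0) := by
      have h' := ENNReal.Tendsto.const_mul (a := volume K ^ (2 : ℝ≥0∞).toReal⁻¹)
        (ENNReal.continuous_ofReal.tendsto 0) (Or.inr hV)
      simp only [ENNReal.ofReal_zero, mul_zero] at h'
      exact h'.mono_left nhdsWithin_le_nhds
    obtain ⟨c, h1, h2⟩ := ((ENNReal.tendsto_nhds_zero.1 h ε hε).and self_mem_nhdsWithin).exists
    exact ⟨c, h2, h1⟩
  have hev : ∀ᶠ s in 𝓝 t, ∀ ξ ∈ K, ‖F s ξ‖ < c := by
    refine hK.eventually_forall_of_forall_eventually fun ξ _ => ?_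
    have : ‖F t ξ‖ < c := by simpa [hF] using hc0
    exact (hFc.norm.tendsto (t, ξ)).eventually (gt_mem_nhds this)
  filter_upwards [nhdsWithin_le_nhds hev, self_mem_nhdsWithin] with s hs hsT
  rw [cosField_sub (hg s hsT) (hg t ht), sobolevENorm_cosField k ((hg s hsT).sub (hg t ht))]
  have hsub : Function.support (F s) ⊆ K := fun ξ hξ => by
    by_contra hn
    exact hξ (by simp [hF, hsupp s hsT ξ hn, hsupp t ht ξ hn])
  change eLpNorm (F s) 2 volume ≤ ε
  rw [← eLpNorm_restrict_eq_of_support_subset hsub]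
  refine le_trans (eLpNorm_le_of_ae_bound (C := c) ?_) (by simpa using hc)
  exact (ae_restrict_iff' hK.measurableSet).2 (ae_of_all _ fun ξ hξ => (hs ξ hξ).le)

theorem l2Norm_cosField (hg : IsEvenDensity g) :
    l2Norm (cosField g) = (eLpNorm g 2 volume).toReal := by
  rw [l2Norm, eLpNorm_cosField hg]

theorem contDiff_cosField (hg : IsEvenDensity g) : ContDiff ℝ ∞ (cosField g) := by
  rw [contDiff_euclidean]
  exact fun j => contDiff_cosTransform (hg.continuous_apply j) (hg.compact_apply j)

theorem tendsto_norm_cosField (hg : IsEvenDensity g) :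
    Tendsto (fun p => ‖cosField g p‖) (cocompact R3) (𝓝 0) := by
  have h : Tendsto (fun p => cosField g p) (cocompact R3) (𝓝 (WithLp.toLp 2 fun _ => 0)) := by
    refine ((PiLp.continuous_toLp 2 _).tendsto _).comp (tendsto_pi_nhds.2 fun j => ?_)
    exact tendsto_cosTransform (hg.integrable_apply j)
  have h0 : (WithLp.toLp 2 fun _ => 0 : R3) = 0 := rfl
  rw [h0] at h
  simpa using h.norm

theorem partialD_cosField_apply (hg : IsEvenDensity g) (i j : Fin 3) (p : R3) :
    partialD i (cosField g) p j = sinTransform (fun ξ => -(2 * Real.pi * ξ i) * g ξ j) p := by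
  rw [← partialD_cosTransform (hg.continuous_apply j) (hg.compact_apply j) i]
  have hd := (contDiff_cosField hg).differentiable (by simp) p
  have h := ((EuclideanSpace.proj (𝕜 := ℝ) j).hasFDerivAt.comp p hd.hasFDerivAt).fderiv
  exact (congrArg (fun A => A (EuclideanSpace.single i 1)) h).symm

theorem laplacian_eq_sum_partialD {φ : R3 → ℝ} (hφ : ContDiff ℝ 2 φ) (p : R3) :
    (Laplacian.laplacian φ : R3 → ℝ) p = ∑ i, partialD i (partialD i φ) p := by
  rw [InnerProductSpace.laplacian_eq_iteratedFDeriv_orthonormalBasis φ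
    (EuclideanSpace.basisFun (Fin 3) ℝ)]
  refine Finset.sum_congr rfl fun i _ => ?_
  rw [iteratedFDeriv_two_apply]
  have hd : DifferentiableAt ℝ (fderiv ℝ φ) p :=
    (hφ.fderiv_right (m := 1) (by norm_num)).differentiable (by simp) p
  have h := (hd.hasFDerivAt.clm_apply
    (hasFDerivAt_const (EuclideanSpace.single i (1 : ℝ) : R3) p)).fderiv
  have h2 := congrArg (fun A => A (EuclideanSpace.single i (1 : ℝ))) h
  simp only [ContinuousLinearMap.comp_zero, zero_add] at h2
  exact (h2.trans (by simp)).symm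

theorem laplacian_cosTransform {g : R3 → ℝ} (hg : Continuous g) (hc : HasCompactSupport g)
    (p : R3) :
    (Laplacian.laplacian (cosTransform g) : R3 → ℝ) p
      = cosTransform (fun ξ => -((2 * Real.pi) ^ 2 * ‖ξ‖ ^ 2) * g ξ) p := by
  rw [laplacian_eq_sum_partialD ((contDiff_cosTransform hg hc).of_le (by norm_cast))]
  have h : ∀ i, partialD i (partialD i (cosTransform g)) =
      cosTransform (fun ξ => 2 * Real.pi * ξ i * (-(2 * Real.pi * ξ i) * g ξ)) := fun i => by
    rw [partialD_cosTransform hg hc]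
    exact partialD_sinTransform (by fun_prop) hc.mul_left i
  simp_rw [h, cosTransform]
  rw [← integral_finsetSum]
  · refine integral_congr_ae (ae_of_all _ fun ξ => ?_)
    simp only [EuclideanSpace.norm_sq_eq, Fin.sum_univ_three, Real.norm_eq_abs, sq_abs]
    ring
  · intro i _
    exact integrable_cos_mul (Continuous.integrable_of_hasCompactSupport (by fun_prop)
      hc.mul_left.mul_left) p

theorem laplacian_sinTransform {g : R3 → ℝ} (hg : Continuous g) (hc : HasCompactSupport g)
    (p : R3) :
    (Laplacian.laplacian (sinTransform g) : R3 → ℝ) p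
      = sinTransform (fun ξ => -((2 * Real.pi) ^ 2 * ‖ξ‖ ^ 2) * g ξ) p := by
  rw [laplacian_eq_sum_partialD ((contDiff_sinTransform hg hc).of_le (by norm_cast))]
  have h : ∀ i, partialD i (partialD i (sinTransform g)) =
      sinTransform (fun ξ => -(2 * Real.pi * ξ i) * (2 * Real.pi * ξ i * g ξ)) := fun i => by
    rw [partialD_sinTransform hg hc]
    exact partialD_cosTransform (by fun_prop) hc.mul_left i
  simp_rw [h, sinTransform]
  rw [← integral_finsetSum]
  · refine integral_congr_ae (ae_of_all _ fun ξ => ?_)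
    simp only [EuclideanSpace.norm_sq_eq, Fin.sum_univ_three, Real.norm_eq_abs, sq_abs]
    ring
  · intro i _
    exact integrable_sin_mul (Continuous.integrable_of_hasCompactSupport (by fun_prop)
      hc.mul_left.mul_left) p

theorem laplacian_cosField_apply (hg : IsEvenDensity g) (p : R3) (j : Fin 3) :
    (Laplacian.laplacian (cosField g) : R3 → R3) p j
      = cosTransform (fun ξ => -((2 * Real.pi) ^ 2 * ‖ξ‖ ^ 2) * g ξ j) p := by
  rw [← laplacian_cosTransform (hg.continuous_apply j) (hg.compact_apply j)]
  have hd : ContDiffAt ℝ 2 (cosField g) p :=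
    ((contDiff_cosField hg).of_le (by norm_cast)).contDiffAt
  exact (hd.laplacian_CLM_comp_left (l := EuclideanSpace.proj (𝕜 := ℝ) j)).symm

theorem gradient_sinTransform {g : R3 → ℝ} (hg : Continuous g) (hc : HasCompactSupport g) :
    gradient (sinTransform g)
      = cosField (fun ξ => WithLp.toLp 2 fun j => 2 * Real.pi * ξ j * g ξ) := by
  ext p j
  have h : (gradient (sinTransform g) p) j = partialD j (sinTransform g) p := by
    unfold gradient partialD
    rw [← InnerProductSpace.toDual_symm_apply, EuclideanSpace.inner_single_right]
    simp
  rw [h, partialD_sinTransform hg hc]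
  rfl

end

/-! ### Equations with a parameter in a compact space -/

open ODE in
/-- A family of differential equations depending continuously on a parameter in a compact space,
with small Lipschitz constant, has a solution on a prescribed time interval that is jointly
continuous in time and parameter and stays near its initial value.  The whole family is one
equation in the Banach space `C(K, E)`, to which the Picard–Lindelöf construction applies. -/
theorem exists_parametrized_solution {K E : Type*} [TopologicalSpace K] [CompactSpace K]
    [LocallyCompactSpace K] [NormedAddCommGroup E] [NormedSpace ℝ E] [CompleteSpace E]
    (G : ℝ → K → E → E) (hG : Continuous fun z : ℝ × K × E => G z.1 z.2.1 z.2.2)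
    {S δ a : ℝ} (hS : 0 < S) (hδ : 0 ≤ δ) (ha : 0 ≤ a) (x₀ : E)
    (hlip : ∀ t, |t| ≤ S → ∀ κ x y, ‖G t κ x - G t κ y‖ ≤ δ * ‖x - y‖)
    (hzero : ∀ t κ, G t κ 0 = 0) (hsmall : δ * (‖x₀‖ + a) * S ≤ a) :
    ∃ X : ℝ → K → E, (Continuous fun z : ℝ × K => X z.1 z.2) ∧ (∀ κ, X 0 κ = x₀) ∧
      (∀ t κ, ‖X t κ - x₀‖ ≤ a) ∧
      ∀ t, |t| < S → ∀ κ, HasDerivAt (fun s => X s κ) (G t κ (X t κ)) t := by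
  lift a to NNReal using ha
  lift δ to NNReal using hδ
  let F : ℝ → C(K, E) → C(K, E) := fun t x => ⟨fun κ => G t κ (x κ),
    hG.comp (continuous_const.prodMk (continuous_id.prodMk x.continuous))⟩
  have hF : Continuous (Function.uncurry F) := by
    refine ContinuousMap.continuous_of_continuous_uncurry _ ?_
    have h : Continuous fun z : (ℝ × C(K, E)) × K => (z.1.1, z.2, z.1.2 z.2) :=
      (continuous_fst.comp continuous_fst).prodMk (continuous_snd.prodMk
        ((continuous_snd.comp continuous_fst).eval continuous_snd))
    exact hG.comp h
  let c : C(K, E) := ContinuousMap.const K x₀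
  have hc : ‖c‖ ≤ ‖x₀‖ := (ContinuousMap.norm_le _ (norm_nonneg _)).2 fun κ => le_rfl
  have hFlip : ∀ t, |t| ≤ S → ∀ x y, ‖F t x - F t y‖ ≤ δ * ‖x - y‖ := fun t ht x y => by
    refine (ContinuousMap.norm_le _ (by positivity)).2 fun κ => (hlip t ht κ _ _).trans ?_
    exact mul_le_mul_of_nonneg_left ((x - y).norm_coe_le_norm κ) δ.2
  let t₀ : Icc (-S) S := ⟨0, by constructor <;> linarith⟩
  have hpl : IsPicardLindelof F t₀ c a 0 (δ * (‖x₀‖₊ + a)) δ := by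
    refine ⟨fun t ht => ?_, fun x _ => ?_, fun t ht x hx => ?_, ?_⟩
    · refine LipschitzOnWith.of_dist_le_mul fun x _ y _ => ?_
      rw [dist_eq_norm, dist_eq_norm]
      exact hFlip t (abs_le.2 ht) x y
    · exact (hF.comp (continuous_id.prodMk continuous_const)).continuousOn
    · have h0 : F t 0 = 0 := by ext κ; exact hzero t κ
      have h1 := hFlip t (abs_le.2 ht) x 0
      rw [h0, sub_zero, sub_zero] at h1
      refine h1.trans (mul_le_mul_of_nonneg_left ?_ δ.2)
      have h2 : ‖x - c‖ ≤ a := by simpa [dist_eq_norm] using hx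
      have h3 := norm_add_le c (x - c)
      rw [add_sub_cancel] at h3
      change ‖x‖ ≤ ‖x₀‖ + a
      linarith
    · change (δ : ℝ) * (‖x₀‖ + a) * max (S - 0) (0 - -S) ≤ a - 0
      simpa using hsmall
  have hc0 : c ∈ Metric.closedBall c ((0 : NNReal) : ℝ) := Metric.mem_closedBall_self le_rfl
  obtain ⟨α, hα⟩ := FunSpace.exists_isFixedPt_next hpl hc0
  rw [FunSpace.isFixedPt_next_iff] at hα
  have hcont : Continuous fun z : ℝ × K => α.compProj z.1 z.2 :=
    ((FunSpace.continuous_compProj α).comp continuous_fst).eval continuous_snd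
  refine ⟨fun t κ => α.compProj t κ, hcont, fun κ => ?_, fun t κ => ?_, fun t ht κ => ?_⟩
  · have h : α.compProj 0 = c := by
      have h1 : α.compProj 0 = α t₀ := FunSpace.compProj_of_mem t₀.2
      rw [h1, FunSpace.apply_of_zero]
    simp only [h]
    rfl
  · have h := FunSpace.compProj_mem_closedBall α hpl.mul_max_le (t := t)
    rw [mem_closedBall_iff_norm] at h
    exact ((α.compProj t - c).norm_coe_le_norm κ).trans h
  · have htI : t ∈ Icc (-S) S := abs_le.1 ht.le
    have h := hasDerivWithinAt_picard_Icc t₀.2 (hF.continuousOn (s := Icc (-S) S ×ˢ univ))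
      (FunSpace.continuous_compProj α).continuousOn (fun _ _ => mem_univ _) c htI
    have h2 : HasDerivWithinAt α.compProj (F t (α.compProj t)) (Icc (-S) S) t :=
      h.congr_of_mem (fun s hs => (FunSpace.compProj_of_mem hs).trans (hα ⟨s, hs⟩)) htI
    have h3 := h2.hasDerivAt (Icc_mem_nhds (abs_lt.1 ht).1 (abs_lt.1 ht).2)
    exact (ContinuousMap.evalCLM ℝ κ).hasFDerivAt.comp_hasDerivAt t h3

/-! ### Kelvin waves close to the growing mode -/

noncomputable section

/-- The wave vector at time `t` of the Kelvin wave with initial wave vector `ξ`: the Couette flow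
shears it in the cross-stream direction. -/
def shear (t : ℝ) (ξ : R3) : R3 := !₂[ξ 0, ξ 1 - t * ξ 0, ξ 2]

@[simp] theorem shear_apply_zero (t : ℝ) (ξ : R3) : shear t ξ 0 = ξ 0 := rfl
@[simp] theorem shear_apply_one (t : ℝ) (ξ : R3) : shear t ξ 1 = ξ 1 - t * ξ 0 := rfl
@[simp] theorem shear_apply_two (t : ℝ) (ξ : R3) : shear t ξ 2 = ξ 2 := rfl

theorem norm_sq_R3 (ξ : R3) : ‖ξ‖ ^ 2 = ξ 0 ^ 2 + ξ 1 ^ 2 + ξ 2 ^ 2 := by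
  simp [EuclideanSpace.norm_sq_eq, Fin.sum_univ_three]

/-- The wave vectors that carry the solution.  The components along `x` and `y` are of smaller order
than the one along `z`, so that the corresponding waves are nearly independent of `x` and `y`. -/
def InBox (ρ : ℝ) (ξ : R3) : Prop :=
  |ξ 0| ≤ ρ ^ 2 ∧ |ξ 1| ≤ ρ ^ 2 ∧ ρ ≤ |ξ 2| ∧ |ξ 2| ≤ 2 * ρ

/-- The pressure amplitude (up to the factor `-1 / 2π`) of a wave with wave vector `ζ` and planar
velocity amplitude `(v₁, v₂)`.  The denominator is `‖ζ‖²` for the waves that occur; the cutoff at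
`ρ²` makes the expression continuous in `ζ`. -/
def pressureCoeff (f ρ : ℝ) (ζ : R3) (v₁ v₂ : ℝ) : ℝ :=
  ((2 - f) * ζ 0 * v₂ + f * ζ 1 * v₁) / max (‖ζ‖ ^ 2) (ρ ^ 2)

/-- `w₁, w₂` are the streamwise and cross-stream amplitudes of a family of Kelvin waves: they solve
the wave equations for initial wave vectors in the box, for `|t| < S`, and stay `τ`-close to the
growing mode `exp (t √(f(1-f))) (-√(1-f), √f)` of the inviscid problem for `z`-dependent fields. -/
structure IsKelvinFamily (ν f ρ S τ : ℝ) (w₁ w₂ : ℝ → R3 → ℝ) : Prop where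
  continuous₁ : Continuous fun z : ℝ × R3 => w₁ z.1 z.2
  continuous₂ : Continuous fun z : ℝ × R3 => w₂ z.1 z.2
  even₁ : ∀ t ξ, w₁ t (-ξ) = w₁ t ξ
  even₂ : ∀ t ξ, w₂ t (-ξ) = w₂ t ξ
  initial₁ : ∀ ξ, w₁ 0 ξ = -√(1 - f)
  initial₂ : ∀ ξ, w₂ 0 ξ = √f
  deriv₁ : ∀ t, |t| < S → ∀ ξ, InBox ρ ξ → HasDerivAt (fun s => w₁ s ξ)
    (-(1 - f) * w₂ t ξ - ν * ((2 * Real.pi) ^ 2 * ‖shear t ξ‖ ^ 2) * w₁ t ξ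
      + shear t ξ 0 * pressureCoeff f ρ (shear t ξ) (w₁ t ξ) (w₂ t ξ)) t
  deriv₂ : ∀ t, |t| < S → ∀ ξ, InBox ρ ξ → HasDerivAt (fun s => w₂ s ξ)
    (-f * w₁ t ξ - ν * ((2 * Real.pi) ^ 2 * ‖shear t ξ‖ ^ 2) * w₂ t ξ
      + shear t ξ 1 * pressureCoeff f ρ (shear t ξ) (w₁ t ξ) (w₂ t ξ)) t
  close₁ : ∀ t, |t| ≤ S → ∀ ξ, |w₁ t ξ - Real.exp (t * √(f * (1 - f))) * -√(1 - f)| ≤ τ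
  close₂ : ∀ t, |t| ≤ S → ∀ ξ, |w₂ t ξ - Real.exp (t * √(f * (1 - f))) * √f| ≤ τ

/-- The planar velocity amplitude with coordinates `x` along the growing and decaying modes. -/
def toPlanar (f t : ℝ) (x : ℝ × ℝ) : ℝ × ℝ :=
  (√(1 - f) * (Real.exp (-(t * √(f * (1 - f)))) * x.2 - Real.exp (t * √(f * (1 - f))) * x.1),
    √f * (Real.exp (t * √(f * (1 - f))) * x.1 + Real.exp (-(t * √(f * (1 - f)))) * x.2))

/-- The inverse of `toPlanar`. -/
def ofPlanar (f t : ℝ) (v : ℝ × ℝ) : ℝ × ℝ :=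
  (Real.exp (-(t * √(f * (1 - f)))) * ((v.2 / √f - v.1 / √(1 - f)) / 2),
    Real.exp (t * √(f * (1 - f))) * ((v.2 / √f + v.1 / √(1 - f)) / 2))

/-- The viscous and pressure terms of the planar wave equations, for the wave vector `(k, h, l)`
with square norm `n`: a small perturbation of the rotation and shear terms when `k, h` are small
compared with `l` and `n` is small. -/
def planarPerturbation (ν f k h n : ℝ) (v : ℝ × ℝ) : ℝ × ℝ :=
  (-(ν * ((2 * Real.pi) ^ 2 * n) * v.1) + k * (((2 - f) * k * v.2 + f * h * v.1) / n),
    -(ν * ((2 * Real.pi) ^ 2 * n) * v.2) + h * (((2 - f) * k * v.2 + f * h * v.1) / n))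

/-- The planar wave equations in the coordinates along the growing and decaying modes. -/
def modeRHS (ν f t k η l : ℝ) (x : ℝ × ℝ) : ℝ × ℝ :=
  ofPlanar f t (planarPerturbation ν f k (η - t * k) (k ^ 2 + (η - t * k) ^ 2 + l ^ 2)
    (toPlanar f t x))

theorem modeRHS_neg (ν f t k η l : ℝ) (x : ℝ × ℝ) :
    modeRHS ν f t (-k) (-η) l x = modeRHS ν f t k η l x := by
  have h : -η - t * -k = -(η - t * k) := by ring
  simp only [modeRHS, planarPerturbation, h]
  congr 2 <;> ring

theorem modeRHS_sub (ν f t k η l : ℝ) (x y : ℝ × ℝ) :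
    modeRHS ν f t k η l x - modeRHS ν f t k η l y = modeRHS ν f t k η l (x - y) := by
  ext <;> simp only [modeRHS, planarPerturbation, toPlanar, ofPlanar, Prod.fst_sub,
    Prod.snd_sub] <;> ring

theorem modeRHS_add_half (ν f t k η l : ℝ) (x y : ℝ × ℝ) :
    (1 / 2 : ℝ) • (modeRHS ν f t k η l x + modeRHS ν f t k η l y)
      = modeRHS ν f t k η l ((1 / 2 : ℝ) • (x + y)) := by
  ext <;> simp only [modeRHS, planarPerturbation, toPlanar, ofPlanar, Prod.smul_fst, Prod.smul_snd,
    Prod.fst_add, Prod.snd_add, smul_eq_mul] <;> ring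

/-- The viscous and pressure terms are of order `ρ²` on the box. -/
theorem norm_planarPerturbation_le {ν f ρ S k h l : ℝ} (hν : 0 ≤ ν) (hf0 : 0 ≤ f) (hf1 : f ≤ 1)
    (hρ : 0 < ρ) (hρ1 : ρ ≤ 1) (hS : 0 ≤ S) (hk : |k| ≤ ρ ^ 2) (hh : |h| ≤ ρ ^ 2 * (1 + S))
    (hl : ρ ≤ l) (hl2 : l ≤ 2 * ρ) (v : ℝ × ℝ) :
    ‖planarPerturbation ν f k h (k ^ 2 + h ^ 2 + l ^ 2) v‖ ≤
      ρ ^ 2 * (ν * ((2 * Real.pi) ^ 2 * (5 + (1 + S) ^ 2)) + 3 * (1 + S) ^ 2) * ‖v‖ := by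
  set n := k ^ 2 + h ^ 2 + l ^ 2 with hn
  have hv1 : |v.1| ≤ ‖v‖ := norm_fst_le v
  have hv2 : |v.2| ≤ ‖v‖ := norm_snd_le v
  have hρ2 : 0 < ρ ^ 2 := by positivity
  have hρ4 : (ρ ^ 2) ^ 2 ≤ ρ ^ 2 := by nlinarith [pow_le_one₀ hρ.le hρ1 (n := 2)]
  have hk2 : k ^ 2 ≤ (ρ ^ 2) ^ 2 := sq_le_sq' (abs_le.1 hk).1 (abs_le.1 hk).2
  have hh2 : h ^ 2 ≤ (ρ ^ 2 * (1 + S)) ^ 2 := sq_le_sq' (abs_le.1 hh).1 (abs_le.1 hh).2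
  have hnρ : ρ ^ 2 ≤ n := by nlinarith [sq_nonneg k, sq_nonneg h]
  have hn0 : 0 < n := lt_of_lt_of_le hρ2 hnρ
  have hnle : n ≤ ρ ^ 2 * (5 + (1 + S) ^ 2) := by
    have h1 : l ^ 2 ≤ 4 * ρ ^ 2 := by nlinarith
    have h2 : (ρ ^ 2 * (1 + S)) ^ 2 ≤ ρ ^ 2 * (1 + S) ^ 2 := by
      rw [mul_pow]; exact mul_le_mul_of_nonneg_right hρ4 (sq_nonneg _)
    nlinarith
  have hk' : |k| ≤ ρ ^ 2 * (1 + S) := hk.trans (by nlinarith)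
  -- the pressure terms: two small components of the wave vector over `n ≥ ρ²`
  have hpress : ∀ e, |e| ≤ ρ ^ 2 * (1 + S) →
      |e * (((2 - f) * k * v.2 + f * h * v.1) / n)| ≤ ρ ^ 2 * (3 * (1 + S) ^ 2) * ‖v‖ := by
    intro e he
    have h1 : |(2 - f) * k * v.2 + f * h * v.1| ≤ 3 * (ρ ^ 2 * (1 + S)) * ‖v‖ := by
      refine (abs_add_le _ _).trans ?_
      rw [abs_mul, abs_mul, abs_mul, abs_mul, abs_of_nonneg (by linarith : 0 ≤ 2 - f),
        abs_of_nonneg hf0]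
      have h2 : (2 - f) * |k| * |v.2| ≤ 2 * (ρ ^ 2 * (1 + S)) * ‖v‖ := by
        gcongr
        linarith
      have h3 : f * |h| * |v.1| ≤ 1 * (ρ ^ 2 * (1 + S)) * ‖v‖ := by gcongr
      linarith
    rw [← mul_div_assoc, abs_div, abs_of_pos hn0, div_le_iff₀ hn0, abs_mul]
    calc |e| * |(2 - f) * k * v.2 + f * h * v.1|
        ≤ (ρ ^ 2 * (1 + S)) * (3 * (ρ ^ 2 * (1 + S)) * ‖v‖) := by gcongr
      _ = ρ ^ 2 * (3 * (1 + S) ^ 2) * ‖v‖ * ρ ^ 2 := by ring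
      _ ≤ _ := by gcongr
  have hvisc : ∀ y, |y| ≤ ‖v‖ → |-(ν * ((2 * Real.pi) ^ 2 * n) * y)| ≤
      ρ ^ 2 * (ν * ((2 * Real.pi) ^ 2 * (5 + (1 + S) ^ 2))) * ‖v‖ := by
    intro y hy
    rw [abs_neg, abs_mul, abs_of_nonneg (by positivity)]
    calc ν * ((2 * Real.pi) ^ 2 * n) * |y|
        ≤ ν * ((2 * Real.pi) ^ 2 * (ρ ^ 2 * (5 + (1 + S) ^ 2))) * ‖v‖ := by gcongr
      _ = _ := by ring
  rw [Prod.norm_def]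
  refine max_le ?_ ?_
  · refine (abs_add_le _ _).trans ((add_le_add (hvisc _ hv1) (hpress k hk')).trans_eq ?_)
    ring
  · refine (abs_add_le _ _).trans ((add_le_add (hvisc _ hv2) (hpress h hh)).trans_eq ?_)
    ring

theorem exp_mul_le {t S Λ : ℝ} (ht : |t| ≤ S) (hΛ : 0 ≤ Λ) : Real.exp (t * Λ) ≤ Real.exp (S * Λ) :=
  Real.exp_le_exp.2 (mul_le_mul_of_nonneg_right (abs_le.1 ht).2 hΛ)

theorem exp_neg_mul_le {t S Λ : ℝ} (ht : |t| ≤ S) (hΛ : 0 ≤ Λ) :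
    Real.exp (-(t * Λ)) ≤ Real.exp (S * Λ) := by
  rw [← neg_mul]
  exact exp_mul_le (by rwa [abs_neg]) hΛ

theorem norm_toPlanar_le {f t S : ℝ} (hf0 : 0 ≤ f) (hf1 : f ≤ 1) (ht : |t| ≤ S) (x : ℝ × ℝ) :
    ‖toPlanar f t x‖ ≤ 2 * Real.exp (S * √(f * (1 - f))) * ‖x‖ := by
  have h1 : |x.1| ≤ ‖x‖ := norm_fst_le x
  have h2 : |x.2| ≤ ‖x‖ := norm_snd_le x
  have e1 := exp_mul_le ht (Real.sqrt_nonneg (f * (1 - f)))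
  have e2 := exp_neg_mul_le ht (Real.sqrt_nonneg (f * (1 - f)))
  have ha : √(1 - f) ≤ 1 := Real.sqrt_le_one.2 (by linarith)
  have hb : √f ≤ 1 := Real.sqrt_le_one.2 hf1
  have k1 : |Real.exp (t * √(f * (1 - f))) * x.1| ≤ Real.exp (S * √(f * (1 - f))) * ‖x‖ := by
    rw [abs_mul, Real.abs_exp]; gcongr
  have k2 : |Real.exp (-(t * √(f * (1 - f)))) * x.2| ≤ Real.exp (S * √(f * (1 - f))) * ‖x‖ := by
    rw [abs_mul, Real.abs_exp]; gcongr
  rw [Prod.norm_def]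
  refine max_le ?_ ?_
  · simp only [toPlanar, Real.norm_eq_abs, abs_mul √(1 - f), abs_of_nonneg (Real.sqrt_nonneg _)]
    refine (mul_le_of_le_one_left (abs_nonneg _) ha).trans ((abs_sub _ _).trans ?_)
    linarith
  · simp only [toPlanar, Real.norm_eq_abs, abs_mul √f, abs_of_nonneg (Real.sqrt_nonneg _)]
    refine (mul_le_of_le_one_left (abs_nonneg _) hb).trans ((abs_add_le _ _).trans ?_)
    linarith

theorem norm_ofPlanar_le {f t S : ℝ} (ht : |t| ≤ S) (v : ℝ × ℝ) :
    ‖ofPlanar f t v‖ ≤ Real.exp (S * √(f * (1 - f))) * (1 / √f + 1 / √(1 - f)) * ‖v‖ := by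
  have h1 : |v.1| ≤ ‖v‖ := norm_fst_le v
  have h2 : |v.2| ≤ ‖v‖ := norm_snd_le v
  have e1 := exp_mul_le ht (Real.sqrt_nonneg (f * (1 - f)))
  have e2 := exp_neg_mul_le ht (Real.sqrt_nonneg (f * (1 - f)))
  have k1 : |v.1 / √(1 - f)| ≤ 1 / √(1 - f) * ‖v‖ := by
    rw [abs_div, abs_of_nonneg (Real.sqrt_nonneg _), div_mul_eq_mul_div, one_mul]; gcongr
  have k2 : |v.2 / √f| ≤ 1 / √f * ‖v‖ := by
    rw [abs_div, abs_of_nonneg (Real.sqrt_nonneg _), div_mul_eq_mul_div, one_mul]; gcongr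
  have k3 : |(v.2 / √f - v.1 / √(1 - f)) / 2| ≤ (1 / √f + 1 / √(1 - f)) * ‖v‖ := by
    rw [abs_div, abs_two]
    have := abs_sub (v.2 / √f) (v.1 / √(1 - f))
    nlinarith [abs_nonneg (v.2 / √f), abs_nonneg (v.1 / √(1 - f))]
  have k4 : |(v.2 / √f + v.1 / √(1 - f)) / 2| ≤ (1 / √f + 1 / √(1 - f)) * ‖v‖ := by
    rw [abs_div, abs_two]
    have := abs_add_le (v.2 / √f) (v.1 / √(1 - f))
    nlinarith [abs_nonneg (v.2 / √f), abs_nonneg (v.1 / √(1 - f))]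
  rw [Prod.norm_def, mul_assoc]
  refine max_le ?_ ?_
  · simp only [ofPlanar, Real.norm_eq_abs]
    rw [abs_mul, Real.abs_exp]
    gcongr
  · simp only [ofPlanar, Real.norm_eq_abs]
    rw [abs_mul, Real.abs_exp]
    gcongr

/-- A solution of the mode equations is a solution of the planar wave equations. -/
theorem hasDerivAt_toPlanar {f t : ℝ} (hf0 : 0 < f) (hf1 : f < 1) {x : ℝ → ℝ × ℝ} {r : ℝ × ℝ}
    (hx : HasDerivAt x (ofPlanar f t r) t) :
    HasDerivAt (fun s => (toPlanar f s (x s)).1) (-(1 - f) * (toPlanar f t (x t)).2 + r.1) t ∧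
      HasDerivAt (fun s => (toPlanar f s (x s)).2) (-f * (toPlanar f t (x t)).1 + r.2) t := by
  have hx1 : HasDerivAt (fun s => (x s).1) (ofPlanar f t r).1 t :=
    (ContinuousLinearMap.fst ℝ ℝ ℝ).hasFDerivAt.comp_hasDerivAt t hx
  have hx2 : HasDerivAt (fun s => (x s).2) (ofPlanar f t r).2 t :=
    (ContinuousLinearMap.snd ℝ ℝ ℝ).hasFDerivAt.comp_hasDerivAt t hx
  have hΛ : √(f * (1 - f)) = √f * √(1 - f) := Real.sqrt_mul hf0.le _
  have hb : √f * √f = f := Real.mul_self_sqrt hf0.le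
  have ha : √(1 - f) * √(1 - f) = 1 - f := Real.mul_self_sqrt (by linarith)
  have hb0 : √f ≠ 0 := (Real.sqrt_pos.2 hf0).ne'
  have ha0 : √(1 - f) ≠ 0 := (Real.sqrt_pos.2 (by linarith)).ne'
  have hlin : HasDerivAt (fun s => s * √(f * (1 - f))) (√(f * (1 - f))) t := by
    simpa using (hasDerivAt_id t).mul_const (√(f * (1 - f)))
  have hp := hlin.exp
  have hm := hlin.neg.exp
  have hpm : Real.exp (t * √(f * (1 - f))) * Real.exp (-(t * √(f * (1 - f)))) = 1 := by
    rw [← Real.exp_add]; simp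
  constructor
  · refine (((hm.mul hx2).sub (hp.mul hx1)).const_mul (√(1 - f))).congr_deriv ?_
    simp only [toPlanar, ofPlanar]
    have e : √(1 - f) * ((r.2 / √f + r.1 / √(1 - f)) / 2 - (r.2 / √f - r.1 / √(1 - f)) / 2)
        = r.1 := by
      field_simp
      ring
    generalize Real.exp (t * √(f * (1 - f))) = p at *
    generalize Real.exp (-(t * √(f * (1 - f)))) = m at *
    linear_combination (-(√(1 - f) * (m * (x t).2 + p * (x t).1))) * hΛ
      - √f * (m * (x t).2 + p * (x t).1) * ha + r.1 * hpm + p * m * e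
  · refine (((hp.mul hx1).add (hm.mul hx2)).const_mul (√f)).congr_deriv ?_
    simp only [toPlanar, ofPlanar]
    have e : √f * ((r.2 / √f + r.1 / √(1 - f)) / 2 + (r.2 / √f - r.1 / √(1 - f)) / 2)
        = r.2 := by
      field_simp
      ring
    generalize Real.exp (t * √(f * (1 - f))) = p at *
    generalize Real.exp (-(t * √(f * (1 - f)))) = m at *
    linear_combination √f * (p * (x t).1 - m * (x t).2) * hΛ
      + √(1 - f) * (p * (x t).1 - m * (x t).2) * hb + r.2 * hpm + p * m * e

/-- Continuity of the mode equations away from the wave vector `0`. -/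
theorem continuous_modeRHS {Z : Type*} [TopologicalSpace Z] {ν f : ℝ} {t k η l : Z → ℝ}
    {x : Z → ℝ × ℝ} (ht : Continuous t) (hk : Continuous k) (hη : Continuous η) (hl : Continuous l)
    (hx : Continuous x) (hl0 : ∀ z, 0 < l z) :
    Continuous fun z => modeRHS ν f (t z) (k z) (η z) (l z) (x z) := by
  have hn : ∀ z, k z ^ 2 + (η z - t z * k z) ^ 2 + l z ^ 2 ≠ 0 := fun z => by
    have := hl0 z
    positivity
  have hp : Continuous fun z => toPlanar f (t z) (x z) := by
    unfold toPlanar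
    fun_prop
  have hr : Continuous fun z => planarPerturbation ν f (k z) (η z - t z * k z)
      (k z ^ 2 + (η z - t z * k z) ^ 2 + l z ^ 2) (toPlanar f (t z) (x z)) := by
    unfold planarPerturbation
    fun_prop (disch := exact hn _)
  unfold modeRHS ofPlanar
  fun_prop

/-- The compact space of absolute wave vectors `(k, η, |l|)` over which the mode equations are
solved. -/
abbrev ParamBox (ρ : ℝ) : Type :=
  Icc (-ρ ^ 2) (ρ ^ 2) × Icc (-ρ ^ 2) (ρ ^ 2) × Icc ρ (2 * ρ)

/-- For every tolerance there are Kelvin waves that follow the growing mode on the prescribed time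
interval, provided the box of wave vectors is small. -/
theorem exists_isKelvinFamily {ν f S τ : ℝ} (hν : 0 < ν) (hf0 : 0 < f) (hf1 : f < 1)
    (hS : 0 < S) (hτ : 0 < τ) :
    ∃ ρ₀ > 0, ∀ ρ, 0 < ρ → ρ ≤ ρ₀ → ∃ w₁ w₂, IsKelvinFamily ν f ρ S τ w₁ w₂ := by
  set E := Real.exp (S * √(f * (1 - f))) with hE
  have hE0 : 0 < E := Real.exp_pos _
  have hb0 : 0 < √f := Real.sqrt_pos.2 hf0
  have ha0 : 0 < √(1 - f) := Real.sqrt_pos.2 (by linarith)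
  -- the mode equations have Lipschitz constant at most `A ρ²`
  set A := E * (1 / √f + 1 / √(1 - f)) *
    ((ν * ((2 * Real.pi) ^ 2 * (5 + (1 + S) ^ 2)) + 3 * (1 + S) ^ 2) * (2 * E)) with hA
  have hA0 : 0 < A := by positivity
  -- the tolerance for the modes that gives the tolerance `τ` for the velocity
  set a := τ / (2 * E) with haa
  have ha : 0 < a := by positivity
  have hc : Tendsto (fun ρ : ℝ => A * ρ ^ 2 * (1 + a) * S) (𝓝 0) (𝓝 0) := by
    have : Continuous fun ρ : ℝ => A * ρ ^ 2 * (1 + a) * S := by fun_prop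
    simpa using this.tendsto 0
  obtain ⟨r, hr0, hr⟩ := Metric.eventually_nhds_iff.1 (hc.eventually (ge_mem_nhds ha))
  refine ⟨min 1 (r / 2), by positivity, fun ρ hρ hρle => ?_⟩
  have hρ1 : ρ ≤ 1 := hρle.trans (min_le_left _ _)
  have hρr : ρ ≤ r / 2 := hρle.trans (min_le_right _ _)
  have hsmall : A * ρ ^ 2 * (1 + a) * S ≤ a := hr (by
    rw [Real.dist_eq, sub_zero, abs_of_pos hρ]; linarith)
  have hρ2 : 0 < ρ ^ 2 := by positivity
  have hI : -ρ ^ 2 ≤ ρ ^ 2 := by linarith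
  have hJ : ρ ≤ 2 * ρ := by linarith
  let G : ℝ → ParamBox ρ → ℝ × ℝ → ℝ × ℝ := fun t κ x => modeRHS ν f t κ.1 κ.2.1 κ.2.2 x
  have hG : Continuous fun z : ℝ × ParamBox ρ × (ℝ × ℝ) => G z.1 z.2.1 z.2.2 :=
    continuous_modeRHS (by fun_prop) (by fun_prop) (by fun_prop) (by fun_prop) (by fun_prop)
      fun z => hρ.trans_le z.2.1.2.2.2.1
  have hlip : ∀ t, |t| ≤ S → ∀ (κ : ParamBox ρ) x y, ‖G t κ x - G t κ y‖ ≤ A * ρ ^ 2 * ‖x - y‖ := by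
    intro t ht κ x y
    have hk : |(κ.1 : ℝ)| ≤ ρ ^ 2 := abs_le.2 κ.1.2
    have hη : |(κ.2.1 : ℝ)| ≤ ρ ^ 2 := abs_le.2 κ.2.1.2
    have hh : |(κ.2.1 : ℝ) - t * κ.1| ≤ ρ ^ 2 * (1 + S) := by
      refine (abs_sub _ _).trans ?_
      rw [abs_mul]
      have : |t| * |(κ.1 : ℝ)| ≤ S * ρ ^ 2 := by gcongr
      linarith
    simp only [G, modeRHS_sub]
    refine (norm_ofPlanar_le ht _).trans ?_
    have h1 := norm_planarPerturbation_le hν.le hf0.le hf1.le hρ hρ1 hS.le hk hh κ.2.2.2.1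
      κ.2.2.2.2 (toPlanar f t (x - y))
    have h2 := norm_toPlanar_le hf0.le hf1.le ht (x - y)
    calc _ ≤ E * (1 / √f + 1 / √(1 - f)) *
          (ρ ^ 2 * (ν * ((2 * Real.pi) ^ 2 * (5 + (1 + S) ^ 2)) + 3 * (1 + S) ^ 2) *
            (2 * E * ‖x - y‖)) := by
          refine mul_le_mul_of_nonneg_left (h1.trans ?_) (by positivity)
          exact mul_le_mul_of_nonneg_left h2 (by positivity)
      _ = _ := by rw [hA]; ring
  have hzero : ∀ t κ, G t κ 0 = 0 := fun t κ => by
    ext <;> simp [G, modeRHS, planarPerturbation, toPlanar, ofPlanar]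
  have hx0 : ‖((1, 0) : ℝ × ℝ)‖ = 1 := by simp [Prod.norm_def]
  obtain ⟨X, hXc, hX0, hXa, hXd⟩ := exists_parametrized_solution G hG hS (by positivity) ha.le
    (1, 0) hlip hzero (by rwa [hx0])
  let κ : R3 → ParamBox ρ := fun ξ =>
    (projIcc _ _ hI (ξ 0), projIcc _ _ hI (ξ 1), projIcc _ _ hJ |ξ 2|)
  have hκ : Continuous κ := by
    refine (continuous_projIcc.comp (by fun_prop)).prodMk
      ((continuous_projIcc.comp (by fun_prop)).prodMk (continuous_projIcc.comp (by fun_prop)))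
  -- averaging over `±ξ` makes the family even; the equations are linear and even in `ξ`
  let Y : ℝ → R3 → ℝ × ℝ := fun t ξ => (1 / 2 : ℝ) • (X t (κ ξ) + X t (κ (-ξ)))
  have hYc : Continuous fun z : ℝ × R3 => Y z.1 z.2 := by
    have h1 : Continuous fun z : ℝ × R3 => X z.1 (κ z.2) :=
      hXc.comp (continuous_fst.prodMk (hκ.comp continuous_snd))
    have h2 : Continuous fun z : ℝ × R3 => X z.1 (κ (-z.2)) :=
      hXc.comp (continuous_fst.prodMk (hκ.comp continuous_snd.neg))
    exact (h1.add h2).const_smul (1 / 2 : ℝ)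
  have hYeven : ∀ t ξ, Y t (-ξ) = Y t ξ := fun t ξ => by
    simp only [Y, neg_neg, add_comm]
  have hY0 : ∀ ξ, Y 0 ξ = (1, 0) := fun ξ => by
    simp only [Y, hX0]
    ext <;> norm_num
  have hYa : ∀ t ξ, ‖Y t ξ - (1, 0)‖ ≤ a := fun t ξ => by
    have h : Y t ξ - (1, 0) =
        (1 / 2 : ℝ) • ((X t (κ ξ) - (1, 0)) + (X t (κ (-ξ)) - (1, 0))) := by
      simp only [Y]
      module
    rw [h, norm_smul]
    have h1 := norm_add_le (X t (κ ξ) - (1, 0)) (X t (κ (-ξ)) - (1, 0))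
    have h2 := hXa t (κ ξ)
    have h3 := hXa t (κ (-ξ))
    norm_num
    linarith
  have hYd : ∀ t, |t| < S → ∀ ξ, InBox ρ ξ → HasDerivAt (fun s => Y s ξ)
      (modeRHS ν f t (ξ 0) (ξ 1) |ξ 2| (Y t ξ)) t := by
    rintro t ht ξ ⟨h0, h1, h2, h3⟩
    have p1 : G t (κ ξ) = modeRHS ν f t (ξ 0) (ξ 1) |ξ 2| := by
      funext x
      simp only [G, κ]
      rw [projIcc_of_mem hI (abs_le.1 h0), projIcc_of_mem hI (abs_le.1 h1),
        projIcc_of_mem hJ ⟨h2, h3⟩]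
    have p2 : G t (κ (-ξ)) = modeRHS ν f t (ξ 0) (ξ 1) |ξ 2| := by
      funext x
      simp only [G, κ, PiLp.neg_apply]
      rw [abs_neg, projIcc_of_mem hI (abs_le.1 (by rwa [abs_neg] : |-ξ 0| ≤ ρ ^ 2)),
        projIcc_of_mem hI (abs_le.1 (by rwa [abs_neg] : |-ξ 1| ≤ ρ ^ 2)),
        projIcc_of_mem hJ ⟨h2, h3⟩]
      exact modeRHS_neg _ _ _ _ _ _ _
    have h := ((hXd t ht (κ ξ)).add (hXd t ht (κ (-ξ)))).const_smul (1 / 2 : ℝ)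
    rw [p1, p2, modeRHS_add_half] at h
    exact h
  have hWd : ∀ t, |t| < S → ∀ ξ, InBox ρ ξ → _ := fun t ht ξ hξ =>
    hasDerivAt_toPlanar hf0 hf1 (hYd t ht ξ hξ)
  -- on the box the cutoff in the pressure is inactive
  have hcut : ∀ t ξ, InBox ρ ξ → max (‖shear t ξ‖ ^ 2) (ρ ^ 2) = ‖shear t ξ‖ ^ 2 ∧
      ξ 0 ^ 2 + (ξ 1 - t * ξ 0) ^ 2 + |ξ 2| ^ 2 = ‖shear t ξ‖ ^ 2 := by
    rintro t ξ ⟨h0, h1, h2, h3⟩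
    have e : ξ 0 ^ 2 + (ξ 1 - t * ξ 0) ^ 2 + |ξ 2| ^ 2 = ‖shear t ξ‖ ^ 2 := by
      rw [norm_sq_R3, sq_abs]; rfl
    refine ⟨max_eq_left ?_, e⟩
    rw [← e]
    nlinarith [sq_nonneg (ξ 0), sq_nonneg (ξ 1 - t * ξ 0)]
  have hclose : ∀ t, |t| ≤ S → ∀ ξ, ‖toPlanar f t (Y t ξ - (1, 0))‖ ≤ τ := fun t ht ξ => by
    refine (norm_toPlanar_le hf0.le hf1.le ht _).trans ?_
    calc 2 * E * ‖Y t ξ - (1, 0)‖ ≤ 2 * E * a := by gcongr; exact hYa t ξ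
      _ = τ := by rw [haa]; field_simp
  have hTc : Continuous fun z : ℝ × R3 => toPlanar f z.1 (Y z.1 z.2) := by
    unfold toPlanar
    fun_prop
  refine ⟨fun t ξ => (toPlanar f t (Y t ξ)).1, fun t ξ => (toPlanar f t (Y t ξ)).2, ?_⟩
  constructor
  · exact hTc.fst
  · exact hTc.snd
  · intro t ξ; simp only [hYeven]
  · intro t ξ; simp only [hYeven]
  · intro ξ; simp [hY0, toPlanar]
  · intro ξ; simp [hY0, toPlanar]
  · intro t ht ξ hξ
    refine (hWd t ht ξ hξ).1.congr_deriv ?_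
    obtain ⟨e1, e2⟩ := hcut t ξ hξ
    simp only [planarPerturbation, pressureCoeff, e1, e2, shear_apply_zero, shear_apply_one]
    ring
  · intro t ht ξ hξ
    refine (hWd t ht ξ hξ).2.congr_deriv ?_
    obtain ⟨e1, e2⟩ := hcut t ξ hξ
    simp only [planarPerturbation, pressureCoeff, e1, e2, shear_apply_zero, shear_apply_one]
    ring
  · intro t ht ξ
    refine le_trans (le_of_eq ?_) ((norm_fst_le _).trans (hclose t ht ξ))
    rw [Real.norm_eq_abs]
    congr 1
    simp only [toPlanar, Prod.fst_sub, Prod.snd_sub]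
    ring
  · intro t ht ξ
    refine le_trans (le_of_eq ?_) ((norm_snd_le _).trans (hclose t ht ξ))
    rw [Real.norm_eq_abs]
    congr 1
    simp only [toPlanar, Prod.fst_sub, Prod.snd_sub]
    ring

end

/-! ### Shearing of wave vectors and the amplitude -/

noncomputable section

/-- Differentiation under the integral sign for integrands with a compactly supported factor. -/
theorem hasDerivAt_integral_mul {b : R3 → ℝ} (hb : Continuous b) (hbc : HasCompactSupport b)
    {F F' : ℝ → R3 → ℝ} (hF : Continuous fun z : ℝ × R3 => F z.1 z.2)
    (hF' : Continuous fun z : ℝ × R3 => F' z.1 z.2) {S : ℝ}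
    (hd : ∀ t, |t| < S → ∀ ξ, b ξ ≠ 0 → HasDerivAt (fun s => F s ξ) (F' t ξ) t)
    {t : ℝ} (ht : |t| < S) :
    HasDerivAt (fun s => ∫ ξ, b ξ * F s ξ) (∫ ξ, b ξ * F' t ξ) t := by
  have hc : ∀ {H : ℝ → R3 → ℝ}, Continuous (fun z : ℝ × R3 => H z.1 z.2) → ∀ s,
      Continuous fun ξ => b ξ * H s ξ := fun hH s =>
    hb.mul (hH.comp (continuous_const.prodMk continuous_id))
  obtain ⟨M, hM⟩ := ((isCompact_Icc (a := -S) (b := S)).prod hbc).exists_bound_of_continuousOn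
    hF'.continuousOn
  have hs : Ioo (-S) S ∈ 𝓝 t := Ioo_mem_nhds (abs_lt.1 ht).1 (abs_lt.1 ht).2
  refine (hasDerivAt_integral_of_dominated_loc_of_deriv_le (μ := volume)
    (F := fun s ξ => b ξ * F s ξ) (F' := fun s ξ => b ξ * F' s ξ) (bound := fun ξ => |b ξ| * M) hs
    (Eventually.of_forall fun s => (hc hF s).aestronglyMeasurable)
    ((hc hF t).integrable_of_hasCompactSupport hbc.mul_right)
    (hc hF' t).aestronglyMeasurable (ae_of_all _ fun ξ s hs => ?_) ?_
    (ae_of_all _ fun ξ s hs => ?_)).2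
  · rw [Real.norm_eq_abs, abs_mul]
    by_cases h : b ξ = 0
    · simp [h]
    · exact mul_le_mul_of_nonneg_left
        (hM (s, ξ) ⟨Ioo_subset_Icc_self hs, subset_tsupport b h⟩) (abs_nonneg _)
  · exact (hb.integrable_of_hasCompactSupport hbc).abs.mul_const M
  · by_cases h : b ξ = 0
    · simpa [h] using hasDerivAt_const s (0 : ℝ)
    · exact (hd s (abs_lt.2 hs) ξ h).const_mul (b ξ)

theorem continuous_shear : Continuous fun z : ℝ × R3 => shear z.1 z.2 := by
  unfold shear
  refine (PiLp.continuous_toLp 2 _).comp (continuous_pi fun i => ?_)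
  fin_cases i <;> simp <;> fun_prop

theorem shear_neg_time (t : ℝ) (ξ : R3) : shear (-t) (shear t ξ) = ξ := by
  ext i; fin_cases i <;> simp [shear]

theorem shear_shear_neg (t : ℝ) (ξ : R3) : shear t (shear (-t) ξ) = ξ := by
  ext i; fin_cases i <;> simp [shear]

theorem shear_neg (t : ℝ) (ξ : R3) : shear t (-ξ) = -shear t ξ := by
  ext i; fin_cases i <;> simp [shear]; ring

theorem shear_zero (ξ : R3) : shear 0 ξ = ξ := by
  ext i; fin_cases i <;> simp [shear]

/-- Shearing preserves volume: its matrix has determinant one. -/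
theorem measurePreserving_shear (t : ℝ) : MeasurePreserving (shear t) volume volume := by
  let M : Matrix (Fin 3) (Fin 3) ℝ := !![1, 0, 0; -t, 1, 0; 0, 0, 1]
  have hM : M.det = 1 := by simp [M, Matrix.det_fin_three]
  have h1 : MeasurePreserving (Matrix.toLin' M) (volume : Measure (Fin 3 → ℝ)) volume :=
    ⟨(Matrix.toLin' M).continuous_of_finiteDimensional.measurable, by
      rw [Real.map_matrix_volume_pi_eq_smul_volume_pi (by rw [hM]; exact one_ne_zero), hM]; simp⟩
  have h := (PiLp.volume_preserving_toLp (Fin 3)).comp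
    (h1.comp (PiLp.volume_preserving_ofLp (Fin 3)))
  have e : shear t = WithLp.toLp 2 ∘ Matrix.toLin' M ∘ WithLp.ofLp := by
    funext ξ
    ext i
    fin_cases i <;> simp [shear, M, dotProduct, Fin.sum_univ_three]
    ring
  rw [e]
  exact h

theorem measurableEmbedding_shear (t : ℝ) : MeasurableEmbedding (shear t) := by
  have hc : ∀ s, Continuous (shear s) := fun s =>
    continuous_shear.comp (continuous_const.prodMk continuous_id)
  exact (Homeomorph.mk ⟨shear t, shear (-t), shear_neg_time t, shear_shear_neg t⟩ (hc t)
    (hc (-t))).measurableEmbedding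

theorem integral_comp_shear (t : ℝ) (φ : R3 → ℝ) : ∫ ξ, φ (shear t ξ) = ∫ ξ, φ ξ :=
  (measurePreserving_shear t).integral_comp (measurableEmbedding_shear t) φ

/-- A continuous even amplitude that lives on the box of wave vectors. -/
def bump (ρ : ℝ) (ξ : R3) : ℝ :=
  max 0 (1 - |ξ 0| / ρ ^ 2) * max 0 (1 - |ξ 1| / ρ ^ 2) * max 0 (1 - |2 * |ξ 2| / ρ - 3|)

theorem continuous_bump (ρ : ℝ) : Continuous (bump ρ) := by
  unfold bump
  fun_prop

theorem bump_neg (ρ : ℝ) (ξ : R3) : bump ρ (-ξ) = bump ρ ξ := by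
  simp [bump]

theorem inBox_of_bump_ne_zero {ρ : ℝ} (hρ : 0 < ρ) {ξ : R3} (h : bump ρ ξ ≠ 0) : InBox ρ ξ := by
  have key : ∀ x : ℝ, max 0 (1 - x) ≠ 0 → x < 1 := fun x hx => by
    by_contra hn
    exact hx (max_eq_left (by linarith))
  simp only [bump, mul_ne_zero_iff] at h
  obtain ⟨⟨h0, h1⟩, h2⟩ := h
  have h0' := (div_lt_one (by positivity)).1 (key _ h0)
  have h1' := (div_lt_one (by positivity)).1 (key _ h1)
  have h2' := abs_lt.1 (key _ h2)
  have h3 : 2 * |ξ 2| / ρ < 4 := by linarith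
  have h4 : 2 < 2 * |ξ 2| / ρ := by linarith
  rw [div_lt_iff₀ hρ] at h3
  rw [lt_div_iff₀ hρ] at h4
  exact ⟨h0'.le, h1'.le, by linarith, by linarith⟩

theorem bump_center {ρ : ℝ} (hρ : 0 < ρ) : bump ρ !₂[0, 0, 3 / 2 * ρ] = 1 := by
  have h : 2 * |3 / 2 * ρ| / ρ - 3 = 0 := by
    rw [abs_of_pos (by positivity)]
    field_simp
    norm_num
  have e : bump ρ !₂[0, 0, 3 / 2 * ρ] = max 0 (1 - |(0 : ℝ)| / ρ ^ 2) *
      max 0 (1 - |(0 : ℝ)| / ρ ^ 2) * max 0 (1 - |2 * |3 / 2 * ρ| / ρ - 3|) := rfl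
  rw [e, h]
  simp

/-- The box is bounded, and so are its images under shearing. -/
theorem norm_le_of_inBox_shear {ρ S t : ℝ} (hρ : 0 < ρ) (ht : |t| ≤ S) {ξ : R3}
    (h : InBox ρ (shear (-t) ξ)) : ‖ξ‖ ≤ ρ ^ 2 + ρ ^ 2 * (1 + S) + 2 * ρ := by
  obtain ⟨h0, h1, -, h3⟩ := h
  simp only [shear_apply_zero, shear_apply_one, shear_apply_two, neg_mul,
    sub_neg_eq_add] at h0 h1 h3
  have hS : 0 ≤ S := (abs_nonneg t).trans ht
  have h1' : |ξ 1| ≤ ρ ^ 2 * (1 + S) := by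
    have e : ξ 1 = (ξ 1 + t * ξ 0) - t * ξ 0 := by ring
    rw [e]
    refine (abs_sub _ _).trans ?_
    rw [abs_mul]
    have : |t| * |ξ 0| ≤ S * ρ ^ 2 := by gcongr
    linarith
  refine abs_le_of_sq_le_sq' ?_ (by positivity) |>.2
  rw [norm_sq_R3, ← sq_abs (ξ 0), ← sq_abs (ξ 1), ← sq_abs (ξ 2)]
  have b0 := pow_le_pow_left₀ (abs_nonneg _) h0 2
  have b1 := pow_le_pow_left₀ (abs_nonneg _) h1' 2
  have b2 := pow_le_pow_left₀ (abs_nonneg _) h3 2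
  have c0 : 0 ≤ ρ ^ 2 := by positivity
  have c1 : 0 ≤ ρ ^ 2 * (1 + S) := by positivity
  nlinarith [mul_nonneg c0 c1, mul_nonneg c0 hρ.le, mul_nonneg c1 hρ.le]

theorem cosTransform_sub {g h : R3 → ℝ} (hg : Integrable g) (hh : Integrable h) (x : R3) :
    cosTransform g x - cosTransform h x = cosTransform (fun ξ => g ξ - h ξ) x := by
  simp only [cosTransform, mul_sub]
  rw [integral_sub (integrable_cos_mul hg x) (integrable_cos_mul hh x)]

theorem mul_cosTransform (c : ℝ) (g : R3 → ℝ) (x : R3) :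
    c * cosTransform g x = cosTransform (fun ξ => c * g ξ) x := by
  simp only [cosTransform, ← integral_const_mul]
  exact integral_congr_ae (ae_of_all _ fun ξ => by ring)

end

/-! ### The spatial equations for a fixed density -/

noncomputable section

/-- The Fourier symbol of the right-hand side of the momentum equation without the transport term,
acting on the velocity amplitude `v` of a wave with wave vector `ζ`. -/
def momentumSymbol (ν f ρ : ℝ) (ζ v : R3) : R3 :=
  !₂[-(1 - f) * v 1 - ν * ((2 * Real.pi) ^ 2 * ‖ζ‖ ^ 2) * v 0
      + ζ 0 * pressureCoeff f ρ ζ (v 0) (v 1),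
    -f * v 0 - ν * ((2 * Real.pi) ^ 2 * ‖ζ‖ ^ 2) * v 1 + ζ 1 * pressureCoeff f ρ ζ (v 0) (v 1),
    -ν * ((2 * Real.pi) ^ 2 * ‖ζ‖ ^ 2) * v 2 + ζ 2 * pressureCoeff f ρ ζ (v 0) (v 1)]

/-- The sine density of the pressure that belongs to the cosine density `g` of the velocity. -/
def pressureDensity (f ρ : ℝ) (g : R3 → R3) (ξ : R3) : ℝ :=
  -(pressureCoeff f ρ ξ (g ξ 0) (g ξ 1)) / (2 * Real.pi)

theorem pressureCoeff_smul (f ρ c : ℝ) (ζ : R3) (v₁ v₂ : ℝ) :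
    pressureCoeff f ρ ζ (c * v₁) (c * v₂) = c * pressureCoeff f ρ ζ v₁ v₂ := by
  simp only [pressureCoeff]; ring

theorem momentumSymbol_smul (ν f ρ c : ℝ) (ζ v : R3) :
    momentumSymbol ν f ρ ζ (c • v) = c • momentumSymbol ν f ρ ζ v := by
  ext i
  fin_cases i <;> simp [momentumSymbol, pressureCoeff_smul] <;> ring

theorem max_norm_sq_pos {ρ : ℝ} (hρ : 0 < ρ) (ζ : R3) : 0 < max (‖ζ‖ ^ 2) (ρ ^ 2) :=
  lt_max_of_lt_right (by positivity)

theorem continuous_pressureCoeff {Z : Type*} [TopologicalSpace Z] {f ρ : ℝ} (hρ : 0 < ρ)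
    {ζ : Z → R3} {v₁ v₂ : Z → ℝ} (hζ : Continuous ζ) (h₁ : Continuous v₁) (h₂ : Continuous v₂) :
    Continuous fun z => pressureCoeff f ρ (ζ z) (v₁ z) (v₂ z) := by
  unfold pressureCoeff
  exact Continuous.div (by fun_prop) (by fun_prop) fun z => (max_norm_sq_pos hρ _).ne'

theorem continuous_momentumSymbol {Z : Type*} [TopologicalSpace Z] {ν f ρ : ℝ} (hρ : 0 < ρ)
    {ζ v : Z → R3} (hζ : Continuous ζ) (hv : Continuous v) :
    Continuous fun z => momentumSymbol ν f ρ (ζ z) (v z) := by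
  have hP := continuous_pressureCoeff (f := f) hρ hζ (v₁ := fun z => v z 0) (v₂ := fun z => v z 1)
    (by fun_prop) (by fun_prop)
  refine (PiLp.continuous_toLp 2 _).comp (continuous_pi fun i => ?_)
  fin_cases i <;> simp <;> fun_prop

theorem integrable_mul_of_compact {b g : R3 → ℝ} (hb : Continuous b) (hg : Continuous g)
    (hc : HasCompactSupport g) : Integrable fun ξ => b ξ * g ξ :=
  (hb.mul hg).integrable_of_hasCompactSupport hc.mul_left

section Density

variable {f ρ : ℝ} {g : R3 → R3}

theorem continuous_pressureDensity (hρ : 0 < ρ) (hg : IsEvenDensity g) :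
    Continuous (pressureDensity f ρ g) :=
  ((continuous_pressureCoeff hρ continuous_id (hg.continuous_apply 0)
    (hg.continuous_apply 1)).neg).div_const _

theorem compact_pressureDensity (hg : IsEvenDensity g) :
    HasCompactSupport (pressureDensity f ρ g) :=
  hasCompactSupport_of_zero hg.compact fun ξ hξ => by simp [pressureDensity, pressureCoeff, hξ]

/-- The wave-number cutoff in the pressure is inactive on the support of `g`. -/
theorem norm_sq_mul_pressureDensity (hρ : 0 < ρ) (hsupp : ∀ ξ, g ξ ≠ 0 → ρ ≤ |ξ 2|) (ξ : R3) :
    (2 * Real.pi) ^ 2 * ‖ξ‖ ^ 2 * pressureDensity f ρ g ξ =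
      -(2 * Real.pi * ((2 - f) * ξ 0 * g ξ 1 + f * ξ 1 * g ξ 0)) := by
  by_cases h : g ξ = 0
  · simp [pressureDensity, pressureCoeff, h]
  · have h2 : ρ ^ 2 ≤ ‖ξ‖ ^ 2 := by
      rw [norm_sq_R3, ← sq_abs (ξ 2)]
      nlinarith [hsupp ξ h, sq_nonneg (ξ 0), sq_nonneg (ξ 1)]
    have h3 : ‖ξ‖ ^ 2 ≠ 0 := (lt_of_lt_of_le (by positivity) h2).ne'
    rw [pressureDensity, pressureCoeff, max_eq_left h2]
    generalize ‖ξ‖ ^ 2 = n at *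
    field_simp

theorem gradient_pressure (hρ : 0 < ρ) (hg : IsEvenDensity g) :
    gradient (sinTransform (pressureDensity f ρ g)) =
      cosField (fun ξ => WithLp.toLp 2 fun j => 2 * Real.pi * ξ j * pressureDensity f ρ g ξ) :=
  gradient_sinTransform (continuous_pressureDensity hρ hg) (compact_pressureDensity hg)

theorem linearizedRHS_cosField (ν : ℝ) (hρ : 0 < ρ) (hg : IsEvenDensity g) (p : R3) (j : Fin 3) :
    linearizedRHS ν f (cosField g) (sinTransform (pressureDensity f ρ g)) p j =
      p 1 * sinTransform (fun ξ => 2 * Real.pi * ξ 0 * g ξ j) p +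
        cosTransform (fun ξ => momentumSymbol ν f ρ ξ (g ξ) j) p := by
  have hQ := continuous_pressureDensity (f := f) hρ hg
  have hQc := compact_pressureDensity (f := f) (ρ := ρ) hg
  have hc := fun i => hg.continuous_apply i
  have hi := fun i => hg.integrable_apply i
  have hL : ∀ i, Integrable fun ξ : R3 => ν * (-((2 * Real.pi) ^ 2 * ‖ξ‖ ^ 2) * g ξ i) := fun i =>
    (integrable_mul_of_compact (by fun_prop) (hc i) (hg.compact_apply i)).const_mul ν
  have hP : ∀ i, Integrable fun ξ : R3 => 2 * Real.pi * ξ i * pressureDensity f ρ g ξ := fun i =>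
    integrable_mul_of_compact (by fun_prop) hQ hQc
  have hx : ∀ ξ i, 2 * Real.pi * ξ i * pressureDensity f ρ g ξ =
      -(ξ i * pressureCoeff f ρ ξ (g ξ 0) (g ξ 1)) := fun ξ i => by
    rw [pressureDensity]; field_simp
  have hS : sinTransform (fun ξ => -(2 * Real.pi * ξ 0) * g ξ j) p =
      -sinTransform (fun ξ => 2 * Real.pi * ξ 0 * g ξ j) p := by
    simp [sinTransform, integral_neg]
  have hLP : ∀ i, ν * cosTransform (fun ξ => -((2 * Real.pi) ^ 2 * ‖ξ‖ ^ 2) * g ξ i) p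
      - cosTransform (fun ξ => 2 * Real.pi * ξ i * pressureDensity f ρ g ξ) p =
      cosTransform (fun ξ => ν * (-((2 * Real.pi) ^ 2 * ‖ξ‖ ^ 2) * g ξ i)
        - 2 * Real.pi * ξ i * pressureDensity f ρ g ξ) p := fun i => by
    rw [mul_cosTransform, cosTransform_sub (hL i) (hP i)]
  have hLPi : ∀ i, Integrable fun ξ => ν * (-((2 * Real.pi) ^ 2 * ‖ξ‖ ^ 2) * g ξ i)
      - 2 * Real.pi * ξ i * pressureDensity f ρ g ξ := fun i => (hL i).sub (hP i)
  have hrhs : linearizedRHS ν f (cosField g) (sinTransform (pressureDensity f ρ g)) p j =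
      ν * cosTransform (fun ξ => -((2 * Real.pi) ^ 2 * ‖ξ‖ ^ 2) * g ξ j) p
        - cosTransform (fun ξ => 2 * Real.pi * ξ j * pressureDensity f ρ g ξ) p
        - ![cosTransform (fun ξ => g ξ 1) p, 0, 0] j
        - p 1 * sinTransform (fun ξ => -(2 * Real.pi * ξ 0) * g ξ j) p
        - f * ![-cosTransform (fun ξ => g ξ 1) p, cosTransform (fun ξ => g ξ 0) p, 0] j := by
    rw [← laplacian_cosField_apply hg, ← partialD_cosField_apply hg, linearizedRHS,
      gradient_pressure hρ hg]
    rfl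
  rw [hrhs, hS, hLP]
  fin_cases j
  · have h : cosTransform (fun ξ => momentumSymbol ν f ρ ξ (g ξ) 0) p =
        cosTransform (fun ξ => ν * (-((2 * Real.pi) ^ 2 * ‖ξ‖ ^ 2) * g ξ 0)
          - 2 * Real.pi * ξ 0 * pressureDensity f ρ g ξ) p
        - (1 - f) * cosTransform (fun ξ => g ξ 1) p := by
      rw [mul_cosTransform, cosTransform_sub (hLPi 0) ((hi 1).const_mul _)]
      congr 1
      funext ξ
      rw [hx]
      simp [momentumSymbol]
      ring
    simp only [Fin.zero_eta, Matrix.cons_val_zero, h]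
    ring
  · have h : cosTransform (fun ξ => momentumSymbol ν f ρ ξ (g ξ) 1) p =
        cosTransform (fun ξ => ν * (-((2 * Real.pi) ^ 2 * ‖ξ‖ ^ 2) * g ξ 1)
          - 2 * Real.pi * ξ 1 * pressureDensity f ρ g ξ) p
        - f * cosTransform (fun ξ => g ξ 0) p := by
      rw [mul_cosTransform, cosTransform_sub (hLPi 1) ((hi 0).const_mul _)]
      congr 1
      funext ξ
      rw [hx]
      simp [momentumSymbol]
      ring
    simp only [Fin.mk_one, Matrix.cons_val_one, Matrix.cons_val_zero, h]
    ring
  · have h : cosTransform (fun ξ => momentumSymbol ν f ρ ξ (g ξ) 2) p =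
        cosTransform (fun ξ => ν * (-((2 * Real.pi) ^ 2 * ‖ξ‖ ^ 2) * g ξ 2)
          - 2 * Real.pi * ξ 2 * pressureDensity f ρ g ξ) p := by
      congr 1
      funext ξ
      rw [hx]
      simp [momentumSymbol]
      ring
    simp only [Fin.reduceFinMk, Matrix.cons_val, h]
    ring

theorem divergence_cosField (hg : IsEvenDensity g) (hdiv : ∀ ξ, ∑ i, ξ i * g ξ i = 0) (p : R3) :
    divergence (cosField g) p = 0 := by
  have h : ∀ i : Fin 3, partialD i (fun p' => cosField g p' i) p =
      sinTransform (fun ξ => -(2 * Real.pi * ξ i) * g ξ i) p := fun i =>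
    congrFun (partialD_cosTransform (hg.continuous_apply i) (hg.compact_apply i) i) p
  simp only [divergence, h, sinTransform]
  rw [← integral_finsetSum]
  · refine integral_eq_zero_of_ae (ae_of_all _ fun ξ => ?_)
    have h2 := hdiv ξ
    simp only [Fin.sum_univ_three, Pi.zero_apply] at h2 ⊢
    linear_combination (-(2 * Real.pi * Real.sin (2 * Real.pi * inner ℝ ξ p))) * h2
  · intro i _
    exact integrable_sin_mul (integrable_mul_of_compact (by fun_prop) (hg.continuous_apply i)
      (hg.compact_apply i)) p

theorem isInverseLaplacian_pressure (hρ : 0 < ρ) (hg : IsEvenDensity g)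
    (hsupp : ∀ ξ, g ξ ≠ 0 → ρ ≤ |ξ 2|) :
    IsInverseLaplacian (pressureSource f (cosField g))
      (fun p => -sinTransform (pressureDensity f ρ g) p) := by
  have hQ := continuous_pressureDensity (f := f) hρ hg
  have hQc := compact_pressureDensity (f := f) (ρ := ρ) hg
  refine ⟨((contDiff_sinTransform hQ hQc).of_le (by norm_cast)).neg, fun p => ?_, ?_⟩
  · have h1 : (Laplacian.laplacian (fun p => -sinTransform (pressureDensity f ρ g) p) : R3 → ℝ) p
        = -(Laplacian.laplacian (sinTransform (pressureDensity f ρ g)) : R3 → ℝ) p :=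
      congrFun InnerProductSpace.laplacian_neg p
    have h2 : ∀ i j : Fin 3, partialD i (fun p' => cosField g p' j) p =
        sinTransform (fun ξ => -(2 * Real.pi * ξ i) * g ξ j) p := fun i j =>
      congrFun (partialD_cosTransform (hg.continuous_apply j) (hg.compact_apply j) i) p
    have hi : ∀ i j : Fin 3, Integrable fun ξ : R3 => Real.sin (2 * Real.pi * inner ℝ ξ p) *
        (-(2 * Real.pi * ξ i) * g ξ j) := fun i j =>
      integrable_sin_mul (integrable_mul_of_compact (by fun_prop) (hg.continuous_apply j)
        (hg.compact_apply j)) p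
    rw [h1, laplacian_sinTransform hQ hQc, pressureSource]
    simp only [h2, sinTransform]
    rw [← integral_neg, ← integral_sub (hi 1 0) (hi 0 1), ← integral_const_mul,
      ← integral_const_mul]
    refine Eq.trans ?_
      (integral_add ((hi 0 1).const_mul 2) (((hi 1 0).sub (hi 0 1)).const_mul f))
    refine integral_congr_ae (ae_of_all _ fun ξ => ?_)
    have h3 := norm_sq_mul_pressureDensity (f := f) hρ hsupp ξ
    beta_reduce
    linear_combination Real.sin (2 * Real.pi * inner ℝ ξ p) * h3
  · have h := (tendsto_sinTransform (hQ.integrable_of_hasCompactSupport hQc)).neg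
    rwa [neg_zero] at h

end Density
end

/-! ### The superposition of Kelvin waves is a solution -/

noncomputable section

/-- The velocity amplitude of a Kelvin wave with planar amplitudes `w₁, w₂`, as a function of time
and of the initial wave vector.  The spanwise component is determined by incompressibility; the
cutoff at `ρ²` only makes it continuous where the amplitude is not used. -/
def waveAmplitude (ρ : ℝ) (w₁ w₂ : ℝ → R3 → ℝ) (t : ℝ) (ξ : R3) : R3 :=
  !₂[w₁ t ξ, w₂ t ξ,
    -(ξ 0 * w₁ t ξ + (ξ 1 - t * ξ 0) * w₂ t ξ) * (ξ 2 / max (ξ 2 ^ 2) (ρ ^ 2))]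

/-- The cosine density of the velocity, as a function of time and of the current wave vector. -/
def velocityDensity (ρ : ℝ) (w₁ w₂ : ℝ → R3 → ℝ) (t : ℝ) (ζ : R3) : R3 :=
  bump ρ (shear (-t) ζ) • waveAmplitude ρ w₁ w₂ t (shear (-t) ζ)

theorem velocityDensity_shear (ρ : ℝ) (w₁ w₂ : ℝ → R3 → ℝ) (t : ℝ) (ξ : R3) :
    velocityDensity ρ w₁ w₂ t (shear t ξ) = bump ρ ξ • waveAmplitude ρ w₁ w₂ t ξ := by
  rw [velocityDensity, shear_neg_time]

theorem inBox_of_velocityDensity_ne_zero {ρ : ℝ} (hρ : 0 < ρ) {w₁ w₂ : ℝ → R3 → ℝ} {t : ℝ} {ζ : R3}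
    (h : velocityDensity ρ w₁ w₂ t ζ ≠ 0) : InBox ρ (shear (-t) ζ) :=
  inBox_of_bump_ne_zero hρ fun h0 => h (by rw [velocityDensity, h0, zero_smul])

/-- On the box the spanwise cutoff is inactive. -/
theorem div_max_of_inBox {ρ : ℝ} (hρ : 0 < ρ) {ξ : R3} (h : InBox ρ ξ) :
    ξ 2 / max (ξ 2 ^ 2) (ρ ^ 2) = (ξ 2)⁻¹ ∧ ξ 2 ≠ 0 := by
  have h0 : ξ 2 ≠ 0 := fun hz => by
    have := h.2.2.1
    rw [hz, abs_zero] at this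
    linarith
  have h1 : ρ ^ 2 ≤ ξ 2 ^ 2 := by
    rw [← sq_abs (ξ 2)]
    exact pow_le_pow_left₀ hρ.le h.2.2.1 2
  refine ⟨?_, h0⟩
  rw [max_eq_left h1]
  field_simp

theorem continuous_coord {Z : Type*} [TopologicalSpace Z] {v : Z → R3} (hv : Continuous v)
    (j : Fin 3) : Continuous fun z => v z j := by
  fun_prop

namespace IsKelvinFamily

variable {ν f ρ S τ : ℝ} {w₁ w₂ : ℝ → R3 → ℝ}

theorem continuous_waveAmplitude (hw : IsKelvinFamily ν f ρ S τ w₁ w₂) (hρ : 0 < ρ) :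
    Continuous fun z : ℝ × R3 => waveAmplitude ρ w₁ w₂ z.1 z.2 := by
  have h1 := hw.continuous₁
  have h2 := hw.continuous₂
  have h3 : Continuous fun z : ℝ × R3 => z.2 2 / max (z.2 2 ^ 2) (ρ ^ 2) :=
    Continuous.div (by fun_prop) (by fun_prop) fun z =>
      (lt_max_of_lt_right (by positivity)).ne'
  refine (PiLp.continuous_toLp 2 _).comp (continuous_pi fun i => ?_)
  fin_cases i <;> simp <;> fun_prop

theorem continuous_velocityDensity (hw : IsKelvinFamily ν f ρ S τ w₁ w₂) (hρ : 0 < ρ) :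
    Continuous fun z : ℝ × R3 => velocityDensity ρ w₁ w₂ z.1 z.2 := by
  have hs : Continuous fun z : ℝ × R3 => shear (-z.1) z.2 :=
    continuous_shear.comp (continuous_fst.neg.prodMk continuous_snd)
  exact ((continuous_bump ρ).comp hs).smul
    ((hw.continuous_waveAmplitude hρ).comp (continuous_fst.prodMk hs))

theorem isEvenDensity (hw : IsKelvinFamily ν f ρ S τ w₁ w₂) (hρ : 0 < ρ) (t : ℝ) :
    IsEvenDensity (velocityDensity ρ w₁ w₂ t) where
  continuous := by
    have h := hw.continuous_velocityDensity hρ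
    have ht : Continuous fun ζ : R3 => (t, ζ) := by fun_prop
    have h' := h.comp ht
    simp only [Function.comp_def] at h'
    exact h'
  compact := by
    refine HasCompactSupport.intro
      (isCompact_closedBall (0 : R3) (ρ ^ 2 + ρ ^ 2 * (1 + |t|) + 2 * ρ)) fun ζ hζ => ?_
    by_contra h
    exact hζ (by
      simpa using norm_le_of_inBox_shear hρ le_rfl (inBox_of_velocityDensity_ne_zero hρ h))
  even ζ := by
    rw [velocityDensity, velocityDensity, shear_neg, bump_neg]
    congr 1
    simp only [waveAmplitude, hw.even₁, hw.even₂, PiLp.neg_apply]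
    ext i
    fin_cases i
    · rfl
    · rfl
    · simp
      ring

/-- The third component of the wave equation follows from the first two and incompressibility. -/
theorem hasDerivAt_waveAmplitude (hw : IsKelvinFamily ν f ρ S τ w₁ w₂) (hρ : 0 < ρ) {t : ℝ}
    (ht : |t| < S) {ξ : R3} (hξ : InBox ρ ξ) (j : Fin 3) :
    HasDerivAt (fun s => waveAmplitude ρ w₁ w₂ s ξ j)
      (momentumSymbol ν f ρ (shear t ξ) (waveAmplitude ρ w₁ w₂ t ξ) j) t := by
  have h1 := hw.deriv₁ t ht ξ hξ
  have h2 := hw.deriv₂ t ht ξ hξ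
  obtain ⟨hl, hl0⟩ := div_max_of_inBox hρ hξ
  fin_cases j
  · exact h1
  · exact h2
  · have hn : ρ ^ 2 ≤ ‖shear t ξ‖ ^ 2 := by
      have := pow_le_pow_left₀ hρ.le hξ.2.2.1 2
      rw [sq_abs] at this
      rw [norm_sq_R3, shear_apply_two]
      nlinarith [sq_nonneg (shear t ξ 0), sq_nonneg (shear t ξ 1)]
    have hP : pressureCoeff f ρ (shear t ξ) (w₁ t ξ) (w₂ t ξ) * ‖shear t ξ‖ ^ 2 =
        (2 - f) * ξ 0 * w₂ t ξ + f * (ξ 1 - t * ξ 0) * w₁ t ξ := by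
      rw [pressureCoeff, max_eq_left hn]
      exact div_mul_cancel₀ _ (lt_of_lt_of_le (by positivity) hn).ne'
    have hns : ‖shear t ξ‖ ^ 2 = ξ 0 ^ 2 + (ξ 1 - t * ξ 0) ^ 2 + ξ 2 ^ 2 := norm_sq_R3 _
    have hlin : HasDerivAt (fun s : ℝ => ξ 1 - s * ξ 0) (-ξ 0) t := by
      simpa using ((hasDerivAt_id t).mul_const (ξ 0)).const_sub (ξ 1)
    have h := (((h1.const_mul (ξ 0)).add (hlin.mul h2)).neg).mul_const
      (ξ 2 / max (ξ 2 ^ 2) (ρ ^ 2))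
    refine h.congr_deriv ?_
    have e : momentumSymbol ν f ρ (shear t ξ) (waveAmplitude ρ w₁ w₂ t ξ) 2 =
        -ν * ((2 * Real.pi) ^ 2 * ‖shear t ξ‖ ^ 2) *
          (-(ξ 0 * w₁ t ξ + (ξ 1 - t * ξ 0) * w₂ t ξ) * (ξ 2 / max (ξ 2 ^ 2) (ρ ^ 2))) +
        ξ 2 * pressureCoeff f ρ (shear t ξ) (w₁ t ξ) (w₂ t ξ) := rfl
    simp only [Fin.reduceFinMk]
    rw [e, hl, shear_apply_zero, shear_apply_one]
    generalize pressureCoeff f ρ (shear t ξ) (w₁ t ξ) (w₂ t ξ) = P at *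
    generalize ‖shear t ξ‖ ^ 2 = n at *
    rw [hns] at hP
    field_simp
    linear_combination -hP

/-- Amplitudes are orthogonal to their wave vectors. -/
theorem sum_mul_velocityDensity (hρ : 0 < ρ) (t : ℝ) (ζ : R3) :
    ∑ i, ζ i * velocityDensity ρ w₁ w₂ t ζ i = 0 := by
  by_cases h : velocityDensity ρ w₁ w₂ t ζ = 0
  · simp [h]
  · have hb := inBox_of_velocityDensity_ne_zero hρ h
    obtain ⟨hl, hl0⟩ := div_max_of_inBox hρ hb
    obtain ⟨ξ, rfl⟩ : ∃ ξ, shear t ξ = ζ := ⟨_, shear_shear_neg t ζ⟩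
    rw [shear_neg_time] at hl hl0
    simp only [velocityDensity_shear, PiLp.smul_apply, smul_eq_mul, Fin.sum_univ_three,
      waveAmplitude]
    simp only [shear_apply_zero, shear_apply_one, shear_apply_two, Matrix.cons_val,
      Matrix.cons_val_zero, Matrix.cons_val_one, hl]
    field_simp
    ring

theorem le_abs_of_velocityDensity_ne_zero (hρ : 0 < ρ) (t : ℝ) (ζ : R3)
    (h : velocityDensity ρ w₁ w₂ t ζ ≠ 0) : ρ ≤ |ζ 2| :=
  (inBox_of_velocityDensity_ne_zero hρ h).2.2.1

/-- The cosine field of a sheared density as a superposition of Kelvin waves. -/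
theorem cosTransform_velocityDensity (t : ℝ) (p : R3) (j : Fin 3) :
    cosTransform (fun ζ => velocityDensity ρ w₁ w₂ t ζ j) p =
      ∫ ξ, bump ρ ξ * (Real.cos (2 * Real.pi * inner ℝ (shear t ξ) p) *
        waveAmplitude ρ w₁ w₂ t ξ j) := by
  rw [cosTransform, ← integral_comp_shear t]
  refine integral_congr_ae (ae_of_all _ fun ξ => ?_)
  simp only [velocityDensity_shear, PiLp.smul_apply, smul_eq_mul]
  ring

theorem compact_bump (hρ : 0 < ρ) : HasCompactSupport (bump ρ) := by
  refine HasCompactSupport.intro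
    (isCompact_closedBall (0 : R3) (ρ ^ 2 + ρ ^ 2 * (1 + 0) + 2 * ρ)) fun ξ hξ => ?_
  by_contra h
  refine hξ ?_
  simpa using norm_le_of_inBox_shear hρ (abs_zero).le
    (by rw [neg_zero, shear_zero]; exact inBox_of_bump_ne_zero hρ h)

theorem hasDerivAt_velocity (hw : IsKelvinFamily ν f ρ S τ w₁ w₂) (hρ : 0 < ρ) {t : ℝ}
    (ht : |t| < S) (p : R3) (j : Fin 3) :
    HasDerivAt (fun s => cosField (velocityDensity ρ w₁ w₂ s) p j)
      (linearizedRHS ν f (cosField (velocityDensity ρ w₁ w₂ t))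
        (sinTransform (pressureDensity f ρ (velocityDensity ρ w₁ w₂ t))) p j) t := by
  have hA := hw.continuous_waveAmplitude hρ
  have hs := continuous_shear
  have hM : Continuous fun z : ℝ × R3 =>
      momentumSymbol ν f ρ (shear z.1 z.2) (waveAmplitude ρ w₁ w₂ z.1 z.2) :=
    continuous_momentumSymbol hρ hs hA
  have hlin : ∀ (t : ℝ) (ξ : R3), HasDerivAt (fun s : ℝ => ξ 1 - s * ξ 0) (-ξ 0) t := fun t ξ => by
    simpa using ((hasDerivAt_id t).mul_const (ξ 0)).const_sub (ξ 1)
  have hphase : ∀ (t : ℝ) (ξ : R3), HasDerivAt (fun s => 2 * Real.pi * inner ℝ (shear s ξ) p)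
      (-(2 * Real.pi * ξ 0 * p 1)) t := fun t ξ => by
    have e : ∀ s, 2 * Real.pi * inner ℝ (shear s ξ) p =
        2 * Real.pi * (ξ 0 * p 0 + (ξ 1 - s * ξ 0) * p 1 + ξ 2 * p 2) := fun s => by
      simp [PiLp.inner_apply, Fin.sum_univ_three]
      ring
    simp_rw [e]
    refine (((((hlin t ξ).mul_const (p 1)).const_add (ξ 0 * p 0)).add_const (ξ 2 * p 2)).const_mul
      (2 * Real.pi)).congr_deriv ?_
    ring
  let F : ℝ → R3 → ℝ := fun t ξ =>
    Real.cos (2 * Real.pi * inner ℝ (shear t ξ) p) * waveAmplitude ρ w₁ w₂ t ξ j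
  let F' : ℝ → R3 → ℝ := fun t ξ =>
    Real.sin (2 * Real.pi * inner ℝ (shear t ξ) p) * (2 * Real.pi * ξ 0 * p 1) *
        waveAmplitude ρ w₁ w₂ t ξ j +
      Real.cos (2 * Real.pi * inner ℝ (shear t ξ) p) *
        momentumSymbol ν f ρ (shear t ξ) (waveAmplitude ρ w₁ w₂ t ξ) j
  have hFc : Continuous fun z : ℝ × R3 => F z.1 z.2 := by
    have h1 : Continuous fun z : ℝ × R3 => Real.cos (2 * Real.pi * inner ℝ (shear z.1 z.2) p) := by
      fun_prop
    exact h1.mul (continuous_coord hA j)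
  have hFc' : Continuous fun z : ℝ × R3 => F' z.1 z.2 := by
    have h1 : Continuous fun z : ℝ × R3 => Real.cos (2 * Real.pi * inner ℝ (shear z.1 z.2) p) := by
      fun_prop
    have h2 : Continuous fun z : ℝ × R3 => Real.sin (2 * Real.pi * inner ℝ (shear z.1 z.2) p) *
        (2 * Real.pi * z.2 0 * p 1) := by
      fun_prop
    exact (h2.mul (continuous_coord hA j)).add (h1.mul (continuous_coord hM j))
  have hFd : ∀ t, |t| < S → ∀ ξ, bump ρ ξ ≠ 0 → HasDerivAt (fun s => F s ξ) (F' t ξ) t := by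
    intro t ht ξ hξ
    refine ((hphase t ξ).cos.mul (hw.hasDerivAt_waveAmplitude hρ ht
      (inBox_of_bump_ne_zero hρ hξ) j)).congr_deriv ?_
    simp only [F']
    ring
  have h := hasDerivAt_integral_mul (continuous_bump ρ) (compact_bump hρ) hFc hFc' hFd ht
  have hg := hw.isEvenDensity hρ t
  have hfun : (fun s => cosField (velocityDensity ρ w₁ w₂ s) p j) =
      fun s => ∫ ξ, bump ρ ξ * F s ξ := funext fun s => cosTransform_velocityDensity s p j
  rw [hfun]
  refine h.congr_deriv ?_
  have hsymb : Continuous fun ζ => momentumSymbol ν f ρ ζ (velocityDensity ρ w₁ w₂ t ζ) :=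
    continuous_momentumSymbol hρ continuous_id hg.continuous
  have hsc : HasCompactSupport fun ζ => momentumSymbol ν f ρ ζ (velocityDensity ρ w₁ w₂ t ζ) j :=
    hasCompactSupport_of_zero hg.compact fun ζ hζ => by
      rw [hζ, ← zero_smul ℝ (0 : R3), momentumSymbol_smul, zero_smul, PiLp.zero_apply]
  have i1 : Integrable fun ζ : R3 => 2 * Real.pi * ζ 0 * velocityDensity ρ w₁ w₂ t ζ j :=
    integrable_mul_of_compact (by fun_prop) (hg.continuous_apply j) (hg.compact_apply j)
  have i2 : Integrable fun ζ : R3 => momentumSymbol ν f ρ ζ (velocityDensity ρ w₁ w₂ t ζ) j :=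
    (continuous_coord hsymb j).integrable_of_hasCompactSupport hsc
  rw [linearizedRHS_cosField ν hρ hg, sinTransform, cosTransform, ← integral_const_mul,
    ← integral_add ((integrable_sin_mul i1 p).const_mul _) (integrable_cos_mul i2 p),
    ← integral_comp_shear t (fun ζ => p 1 * (Real.sin (2 * Real.pi * inner ℝ ζ p) *
      (2 * Real.pi * ζ 0 * velocityDensity ρ w₁ w₂ t ζ j)) + Real.cos (2 * Real.pi * inner ℝ ζ p) *
        momentumSymbol ν f ρ ζ (velocityDensity ρ w₁ w₂ t ζ) j)]
  refine integral_congr_ae (ae_of_all _ fun ξ => ?_)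
  simp only [F', velocityDensity_shear, momentumSymbol_smul, PiLp.smul_apply, smul_eq_mul,
    shear_apply_zero]
  ring

theorem norm_le_of_velocityDensity_ne_zero (hρ : 0 < ρ) {T t : ℝ} (ht : t ∈ Icc 0 T) {ζ : R3}
    (h : velocityDensity ρ w₁ w₂ t ζ ≠ 0) : ‖ζ‖ ≤ ρ ^ 2 + ρ ^ 2 * (1 + T) + 2 * ρ :=
  norm_le_of_inBox_shear hρ (by rw [abs_of_nonneg ht.1]; exact ht.2)
    (inBox_of_velocityDensity_ne_zero hρ h)

/-- The superposition of a Kelvin family is a classical solution. -/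
theorem isLinearizedSolution (hw : IsKelvinFamily ν f ρ S τ w₁ w₂) (hρ : 0 < ρ) {T : ℝ}
    (hTS : T < S) :
    IsLinearizedSolution ν f T (fun t => cosField (velocityDensity ρ w₁ w₂ t))
      (fun t => sinTransform (pressureDensity f ρ (velocityDensity ρ w₁ w₂ t))) where
  smooth t _ := contDiff_cosField (hw.isEvenDensity hρ t)
  smooth_pressure t _ := contDiff_sinTransform
    (continuous_pressureDensity hρ (hw.isEvenDensity hρ t))
    (compact_pressureDensity (hw.isEvenDensity hρ t))
  continuous_velocity k := by
    refine continuousInHk_cosField k T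
      (isCompact_closedBall (0 : R3) (ρ ^ 2 + ρ ^ 2 * (1 + T) + 2 * ρ))
      (hw.continuous_velocityDensity hρ) (fun t ht ζ hζ => ?_) fun t _ => hw.isEvenDensity hρ t
    by_contra h
    exact hζ (by simpa using norm_le_of_velocityDensity_ne_zero hρ ht h)
  continuous_pressure k := by
    have hV := hw.continuous_velocityDensity hρ
    have hQ : Continuous fun z : ℝ × R3 =>
        pressureDensity f ρ (velocityDensity ρ w₁ w₂ z.1) z.2 :=
      ((continuous_pressureCoeff hρ continuous_snd
        (continuous_coord hV 0) (continuous_coord hV 1)).neg).div_const _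
    have hz : ∀ t ζ, velocityDensity ρ w₁ w₂ t ζ = 0 → (WithLp.toLp 2 fun j : Fin 3 =>
        2 * Real.pi * ζ j * pressureDensity f ρ (velocityDensity ρ w₁ w₂ t) ζ : R3) = 0 := by
      intro t ζ h
      ext j
      simp [pressureDensity, pressureCoeff, h]
    have hcont : Continuous fun z : ℝ × R3 => (WithLp.toLp 2 fun j : Fin 3 =>
        2 * Real.pi * z.2 j * pressureDensity f ρ (velocityDensity ρ w₁ w₂ z.1) z.2 : R3) :=
      (PiLp.continuous_toLp 2 _).comp (continuous_pi fun j => by fun_prop)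
    have heq : (fun t => gradient (sinTransform
        (pressureDensity f ρ (velocityDensity ρ w₁ w₂ t)))) = fun t => cosField fun ζ =>
          WithLp.toLp 2 fun j =>
            2 * Real.pi * ζ j * pressureDensity f ρ (velocityDensity ρ w₁ w₂ t) ζ :=
      funext fun t => gradient_pressure hρ (hw.isEvenDensity hρ t)
    rw [heq]
    refine continuousInHk_cosField k T
      (isCompact_closedBall (0 : R3) (ρ ^ 2 + ρ ^ 2 * (1 + T) + 2 * ρ)) (g := fun t ζ =>
        WithLp.toLp 2 fun j =>
          2 * Real.pi * ζ j * pressureDensity f ρ (velocityDensity ρ w₁ w₂ t) ζ)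
      hcont (fun t ht ζ hζ => ?_) fun t _ => ?_
    · refine hz t ζ ?_
      by_contra h
      exact hζ (by simpa using norm_le_of_velocityDensity_ne_zero hρ ht h)
    · have hg := hw.isEvenDensity hρ t
      have ht : Continuous fun ζ : R3 => (t, ζ) := by fun_prop
      refine ⟨hcont.comp ht, hasCompactSupport_of_zero hg.compact fun ζ => hz t ζ, fun ζ => ?_⟩
      ext j
      simp [pressureDensity, pressureCoeff, hg.even]
      ring
  momentum t ht p := by
    have ht' : |t| < S := by rw [abs_of_nonneg ht.1]; exact ht.2.trans_lt hTS
    have h := hasDerivAt_pi.2 fun j => hw.hasDerivAt_velocity hρ ht' p j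
    exact ((PiLp.continuousLinearEquiv 2 ℝ fun _ : Fin 3 => ℝ).symm.hasFDerivAt.comp_hasDerivAt t
      h).hasDerivWithinAt
  pressure t _ := isInverseLaplacian_pressure hρ (hw.isEvenDensity hρ t)
    (le_abs_of_velocityDensity_ne_zero hρ t)
  div_free t _ := divergence_cosField (hw.isEvenDensity hρ t) (sum_mul_velocityDensity hρ t)
  far_field t _ := tendsto_norm_cosField (hw.isEvenDensity hρ t)

end IsKelvinFamily
end

/-! ### Growth of the solution -/

noncomputable section

/-- If `V` is pointwise close to `c W` relative to `W`, then so are the `L²` norms. -/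
theorem eLpNorm_bounds_of_close {V W : R3 → R3} (hV : MemLp V 2 (volume : Measure R3))
    (hW : MemLp W 2 (volume : Measure R3)) {c ε : ℝ} (hc : 0 ≤ c)
    (h : ∀ ξ, ‖V ξ - c • W ξ‖ ≤ ε * ‖W ξ‖) :
    (c - ε) * (eLpNorm W 2 volume).toReal ≤ (eLpNorm V 2 volume).toReal ∧
      (eLpNorm V 2 volume).toReal ≤ (c + ε) * (eLpNorm W 2 volume).toReal := by
  rw [← Lp.norm_toLp V hV, ← Lp.norm_toLp W hW]
  have h1 : ‖hV.toLp V - c • hW.toLp W‖ ≤ ε * ‖hW.toLp W‖ := by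
    refine Lp.norm_le_mul_norm_of_ae_le_mul ?_
    filter_upwards [Lp.coeFn_sub (hV.toLp V) (c • hW.toLp W), Lp.coeFn_smul c (hW.toLp W),
      hV.coeFn_toLp, hW.coeFn_toLp] with ξ e1 e2 e3 e4
    rw [e1, Pi.sub_apply, e2, Pi.smul_apply, e3, e4]
    exact h ξ
  have h2 : ‖c • hW.toLp W‖ = c * ‖hW.toLp W‖ := by
    rw [norm_smul, Real.norm_of_nonneg hc]
  have h3 := norm_sub_norm_le (hV.toLp V) (c • hW.toLp W)
  have h4 := norm_sub_norm_le (c • hW.toLp W) (hV.toLp V)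
  rw [norm_sub_rev] at h4
  constructor <;> linarith

/-- A density carried by wave vectors with `‖2π ξ‖ ≤ 1` has Sobolev norms comparable with its
`L²` norm. -/
theorem sobolevNorm_cosField_le {g : R3 → R3} (hg : IsEvenDensity g)
    (hsupp : ∀ ξ, g ξ ≠ 0 → (2 * Real.pi * ‖ξ‖) ^ 2 ≤ 1) (k : ℕ) :
    sobolevNorm k (cosField g) ≤ 2 ^ k * l2Norm (cosField g) := by
  have h : eLpNorm (fun ξ : R3 => (1 + (2 * Real.pi * ‖ξ‖) ^ 2) ^ ((k : ℝ) / 2) • g ξ) 2 volume ≤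
      ENNReal.ofReal (2 ^ k) * eLpNorm g 2 volume := by
    refine eLpNorm_le_mul_eLpNorm_of_ae_le_mul (ae_of_all _ fun ξ => ?_) 2
    by_cases hz : g ξ = 0
    · simp [hz]
    rw [norm_smul, Real.norm_of_nonneg (by positivity)]
    refine mul_le_mul_of_nonneg_right ?_ (norm_nonneg _)
    calc (1 + (2 * Real.pi * ‖ξ‖) ^ 2) ^ ((k : ℝ) / 2) ≤ 2 ^ ((k : ℝ) / 2) :=
          Real.rpow_le_rpow (by positivity) (by linarith [hsupp ξ hz]) (by positivity)
      _ ≤ 2 ^ (k : ℝ) := Real.rpow_le_rpow_of_exponent_le one_le_two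
          (half_le_self (Nat.cast_nonneg k))
      _ = 2 ^ k := Real.rpow_natCast 2 k
  have hm : MemLp g 2 (volume : Measure R3) :=
    hg.continuous.memLp_of_hasCompactSupport hg.compact
  rw [sobolevNorm, sobolevENorm_cosField k hg, l2Norm_cosField hg]
  refine (ENNReal.toReal_mono (ENNReal.mul_ne_top ENNReal.ofReal_ne_top hm.eLpNorm_ne_top)
    h).trans_eq ?_
  rw [ENNReal.toReal_mul, ENNReal.toReal_ofReal (by positivity)]

theorem norm_le_sum_abs (v : R3) : ‖v‖ ≤ |v 0| + |v 1| + |v 2| := by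
  refine abs_le_of_sq_le_sq' ?_ (by positivity) |>.2
  rw [norm_sq_R3, ← sq_abs (v 0), ← sq_abs (v 1), ← sq_abs (v 2)]
  nlinarith [mul_nonneg (abs_nonneg (v 0)) (abs_nonneg (v 1)),
    mul_nonneg (abs_nonneg (v 0)) (abs_nonneg (v 2)),
    mul_nonneg (abs_nonneg (v 1)) (abs_nonneg (v 2))]

namespace IsKelvinFamily

variable {ν f ρ S τ : ℝ} {w₁ w₂ : ℝ → R3 → ℝ}

theorem one_le_norm_waveAmplitude_zero (hw : IsKelvinFamily ν f ρ S τ w₁ w₂) (hf0 : 0 ≤ f)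
    (hf1 : f ≤ 1) (ξ : R3) : 1 ≤ ‖waveAmplitude ρ w₁ w₂ 0 ξ‖ := by
  have h : (1 : ℝ) ^ 2 ≤ ‖waveAmplitude ρ w₁ w₂ 0 ξ‖ ^ 2 := by
    have e0 : waveAmplitude ρ w₁ w₂ 0 ξ 0 = -√(1 - f) := hw.initial₁ ξ
    have e1 : waveAmplitude ρ w₁ w₂ 0 ξ 1 = √f := hw.initial₂ ξ
    rw [norm_sq_R3, e0, e1, neg_sq, Real.sq_sqrt hf0, Real.sq_sqrt (by linarith)]
    nlinarith [sq_nonneg (waveAmplitude ρ w₁ w₂ 0 ξ 2)]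
  exact (abs_le_of_sq_le_sq' h (norm_nonneg _)).2

/-- The spanwise component is small, because the wave vectors are nearly spanwise. -/
theorem abs_waveAmplitude_two_le (hw : IsKelvinFamily ν f ρ S τ w₁ w₂) (hρ : 0 < ρ) (hf0 : 0 ≤ f)
    (hf1 : f ≤ 1) {t : ℝ} (ht : |t| ≤ S) {ξ : R3} (hξ : InBox ρ ξ) :
    |waveAmplitude ρ w₁ w₂ t ξ 2| ≤ ρ * ((2 + S) * (Real.exp (S * √(f * (1 - f))) + τ)) := by
  set E := Real.exp (S * √(f * (1 - f))) with hE
  have hS : 0 ≤ S := (abs_nonneg t).trans ht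
  have hexp := exp_mul_le ht (Real.sqrt_nonneg (f * (1 - f)))
  have ha : √(1 - f) ≤ 1 := Real.sqrt_le_one.2 (by linarith)
  have hb : √f ≤ 1 := Real.sqrt_le_one.2 hf1
  have key : ∀ w c : ℝ, |c| ≤ 1 → |w - Real.exp (t * √(f * (1 - f))) * c| ≤ τ → |w| ≤ E + τ := by
    intro w c hc h
    have h1 : |Real.exp (t * √(f * (1 - f))) * c| ≤ E := by
      rw [abs_mul, Real.abs_exp]
      exact (mul_le_of_le_one_right (Real.exp_pos _).le hc).trans hexp
    have h2 := abs_sub_abs_le_abs_sub w (Real.exp (t * √(f * (1 - f))) * c)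
    linarith
  have h1 : |w₁ t ξ| ≤ E + τ := key _ _
    (by rw [abs_neg, abs_of_nonneg (Real.sqrt_nonneg _)]; exact ha) (hw.close₁ t ht ξ)
  have h2 : |w₂ t ξ| ≤ E + τ := key _ _
    (by rw [abs_of_nonneg (Real.sqrt_nonneg _)]; exact hb) (hw.close₂ t ht ξ)
  have hEτ : 0 ≤ E + τ := (abs_nonneg _).trans h1
  obtain ⟨hl, hl0⟩ := div_max_of_inBox hρ hξ
  obtain ⟨k0, k1, k2, -⟩ := hξ
  have e : waveAmplitude ρ w₁ w₂ t ξ 2 =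
      -(ξ 0 * w₁ t ξ + (ξ 1 - t * ξ 0) * w₂ t ξ) * (ξ 2 / max (ξ 2 ^ 2) (ρ ^ 2)) := rfl
  have hη : |ξ 1 - t * ξ 0| ≤ ρ ^ 2 * (1 + S) := by
    refine (abs_sub _ _).trans ?_
    rw [abs_mul]
    have : |t| * |ξ 0| ≤ S * ρ ^ 2 := by gcongr
    linarith
  have hnum : |ξ 0 * w₁ t ξ + (ξ 1 - t * ξ 0) * w₂ t ξ| ≤ ρ ^ 2 * ((2 + S) * (E + τ)) := by
    refine (abs_add_le _ _).trans ?_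
    rw [abs_mul, abs_mul]
    have m1 : |ξ 0| * |w₁ t ξ| ≤ ρ ^ 2 * (E + τ) := by gcongr
    have m2 : |ξ 1 - t * ξ 0| * |w₂ t ξ| ≤ ρ ^ 2 * (1 + S) * (E + τ) := by gcongr
    linarith
  rw [e, hl, abs_mul, abs_neg, abs_inv, ← div_eq_mul_inv, div_le_iff₀ (hρ.trans_le k2)]
  refine hnum.trans ?_
  calc ρ ^ 2 * ((2 + S) * (E + τ)) = ρ * ((2 + S) * (E + τ)) * ρ := by ring
    _ ≤ _ := by gcongr

/-- Each wave grows like the exponential, up to a small relative error. -/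
theorem norm_waveAmplitude_sub_le (hw : IsKelvinFamily ν f ρ S τ w₁ w₂) (hρ : 0 < ρ) (hf0 : 0 ≤ f)
    (hf1 : f ≤ 1)
    (hρτ : ρ * ((2 + S) * (Real.exp (S * √(f * (1 - f))) + τ)) *
      (1 + Real.exp (S * √(f * (1 - f)))) ≤ τ) {t : ℝ} (ht : |t| ≤ S) {ξ : R3} (hξ : InBox ρ ξ) :
    ‖waveAmplitude ρ w₁ w₂ t ξ - Real.exp (t * √(f * (1 - f))) • waveAmplitude ρ w₁ w₂ 0 ξ‖ ≤
      3 * τ := by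
  have hS : 0 ≤ S := (abs_nonneg t).trans ht
  have hexp := exp_mul_le ht (Real.sqrt_nonneg (f * (1 - f)))
  have h0 := hw.close₁ t ht ξ
  have h1 := hw.close₂ t ht ξ
  have h2 := hw.abs_waveAmplitude_two_le hρ hf0 hf1 ht hξ
  have h3 := hw.abs_waveAmplitude_two_le hρ hf0 hf1 (t := 0) (by simpa using hS) hξ
  refine (norm_le_sum_abs _).trans ?_
  simp only [PiLp.sub_apply, PiLp.smul_apply, smul_eq_mul]
  have e0 : waveAmplitude ρ w₁ w₂ 0 ξ 0 = -√(1 - f) := hw.initial₁ ξ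
  have e1 : waveAmplitude ρ w₁ w₂ 0 ξ 1 = √f := hw.initial₂ ξ
  rw [e0, e1]
  have h0' : |waveAmplitude ρ w₁ w₂ t ξ 0 - Real.exp (t * √(f * (1 - f))) * -√(1 - f)| ≤ τ := h0
  have h1' : |waveAmplitude ρ w₁ w₂ t ξ 1 - Real.exp (t * √(f * (1 - f))) * √f| ≤ τ := h1
  have h4 : |waveAmplitude ρ w₁ w₂ t ξ 2 -
      Real.exp (t * √(f * (1 - f))) * waveAmplitude ρ w₁ w₂ 0 ξ 2| ≤ τ := by
    refine (abs_sub _ _).trans (le_trans ?_ hρτ)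
    rw [abs_mul, Real.abs_exp]
    have := mul_le_mul hexp h3 (abs_nonneg _) (Real.exp_pos _).le
    linarith
  linarith

theorem eLpNorm_velocityDensity (hw : IsKelvinFamily ν f ρ S τ w₁ w₂) (hρ : 0 < ρ) (t : ℝ) :
    eLpNorm (velocityDensity ρ w₁ w₂ t) 2 volume =
      eLpNorm (fun ξ => bump ρ ξ • waveAmplitude ρ w₁ w₂ t ξ) 2 volume := by
  rw [← eLpNorm_comp_measurePreserving (hw.isEvenDensity hρ t).continuous.aestronglyMeasurable
    (measurePreserving_shear t)]
  congr 1
  funext ξ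
  exact velocityDensity_shear ρ w₁ w₂ t ξ

theorem memLp_wave (hw : IsKelvinFamily ν f ρ S τ w₁ w₂) (hρ : 0 < ρ) (t : ℝ) :
    MemLp (fun ξ => bump ρ ξ • waveAmplitude ρ w₁ w₂ t ξ) 2 (volume : Measure R3) := by
  have ht : Continuous fun ξ : R3 => (t, ξ) := by fun_prop
  have h := (hw.continuous_waveAmplitude hρ).comp ht
  simp only [Function.comp_def] at h
  exact ((continuous_bump ρ).smul h).memLp_of_hasCompactSupport
    (hasCompactSupport_of_zero (compact_bump hρ) fun ξ hξ => by
      rw [Pi.smul_apply', hξ, zero_smul])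

theorem l2Norm_bounds (hw : IsKelvinFamily ν f ρ S τ w₁ w₂) (hρ : 0 < ρ) (hf0 : 0 ≤ f)
    (hf1 : f ≤ 1) (hτ : 0 ≤ τ)
    (hρτ : ρ * ((2 + S) * (Real.exp (S * √(f * (1 - f))) + τ)) *
      (1 + Real.exp (S * √(f * (1 - f)))) ≤ τ) {t : ℝ} (ht : |t| ≤ S) :
    (Real.exp (t * √(f * (1 - f))) - 3 * τ) * l2Norm (cosField (velocityDensity ρ w₁ w₂ 0)) ≤
        l2Norm (cosField (velocityDensity ρ w₁ w₂ t)) ∧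
      l2Norm (cosField (velocityDensity ρ w₁ w₂ t)) ≤
        (Real.exp (t * √(f * (1 - f))) + 3 * τ) *
          l2Norm (cosField (velocityDensity ρ w₁ w₂ 0)) := by
  rw [l2Norm_cosField (hw.isEvenDensity hρ t), l2Norm_cosField (hw.isEvenDensity hρ 0),
    hw.eLpNorm_velocityDensity hρ t, hw.eLpNorm_velocityDensity hρ 0]
  refine eLpNorm_bounds_of_close (hw.memLp_wave hρ t) (hw.memLp_wave hρ 0) (Real.exp_pos _).le
    fun ξ => ?_
  rw [smul_comm, ← smul_sub, norm_smul, norm_smul]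
  by_cases hb : bump ρ ξ = 0
  · simp [hb]
  have h1 := hw.norm_waveAmplitude_sub_le hρ hf0 hf1 hρτ ht (inBox_of_bump_ne_zero hρ hb)
  have h2 := hw.one_le_norm_waveAmplitude_zero hf0 hf1 ξ
  calc _ ≤ ‖bump ρ ξ‖ * (3 * τ * 1) := by
        rw [mul_one]; exact mul_le_mul_of_nonneg_left h1 (norm_nonneg _)
    _ ≤ ‖bump ρ ξ‖ * (3 * τ * ‖waveAmplitude ρ w₁ w₂ 0 ξ‖) := by gcongr
    _ = _ := by ring

theorem velocity_zero_ne_zero (hw : IsKelvinFamily ν f ρ S τ w₁ w₂) (hρ : 0 < ρ) (hf0 : 0 ≤ f)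
    (hf1 : f ≤ 1) : cosField (velocityDensity ρ w₁ w₂ 0) ≠ 0 := by
  intro h
  have hg := hw.isEvenDensity hρ 0
  have h1 := eLpNorm_cosField hg
  rw [h, eLpNorm_zero] at h1
  have h2 := (eLpNorm_eq_zero_iff hg.continuous.aestronglyMeasurable two_ne_zero).1 h1.symm
  have h3 := (hg.continuous.ae_eq_iff_eq volume continuous_zero).1 h2
  have h4 := congrFun h3 !₂[0, 0, 3 / 2 * ρ]
  have h5 := velocityDensity_shear ρ w₁ w₂ 0 !₂[0, 0, 3 / 2 * ρ]
  rw [shear_zero, h4, bump_center hρ, one_smul, Pi.zero_apply] at h5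
  have h6 := hw.one_le_norm_waveAmplitude_zero hf0 hf1 !₂[0, 0, 3 / 2 * ρ]
  rw [← h5, norm_zero] at h6
  linarith

/-- For small boxes the initial velocity only involves wavelengths at least `2π`. -/
theorem sobolevNorm_velocity_zero_le (hw : IsKelvinFamily ν f ρ S τ w₁ w₂) (hρ : 0 < ρ)
    (hρ1 : ρ ≤ 1 / 20) (k : ℕ) :
    sobolevNorm k (cosField (velocityDensity ρ w₁ w₂ 0)) ≤
      2 ^ k * l2Norm (cosField (velocityDensity ρ w₁ w₂ 0)) := by
  refine sobolevNorm_cosField_le (hw.isEvenDensity hρ 0) (fun ξ hξ => ?_) k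
  have hb := inBox_of_velocityDensity_ne_zero hρ hξ
  rw [neg_zero, shear_zero] at hb
  obtain ⟨h0, h1, -, h3⟩ := hb
  have b0 := pow_le_pow_left₀ (abs_nonneg _) h0 2
  have b1 := pow_le_pow_left₀ (abs_nonneg _) h1 2
  have b2 := pow_le_pow_left₀ (abs_nonneg _) h3 2
  rw [sq_abs] at b0 b1 b2
  have hρ2 : ρ ^ 2 ≤ 1 / 400 := by nlinarith
  have hρ4 : (ρ ^ 2) ^ 2 ≤ ρ ^ 2 := by nlinarith [sq_nonneg ρ]
  have hn : ‖ξ‖ ^ 2 ≤ 6 / 400 := by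
    rw [norm_sq_R3]
    nlinarith
  have hπ : Real.pi ^ 2 ≤ 16 := by nlinarith [Real.pi_le_four, Real.pi_pos]
  calc (2 * Real.pi * ‖ξ‖) ^ 2 = 4 * (Real.pi ^ 2 * ‖ξ‖ ^ 2) := by ring
    _ ≤ 4 * (16 * (6 / 400)) := by gcongr
    _ ≤ 1 := by norm_num

end IsKelvinFamily

end

theorem mainTheorem2 (ν f : ℝ) (hν : 0 < ν) (hf0 : 0 < f) (hf1 : f < 1) :
    ∃ C : ℕ → ℝ, (∀ k, 0 < C k) ∧
      ∀ T ε : ℝ, 0 < T → 0 < ε →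
        ∃ (u : ℝ → R3 → R3) (q : ℝ → R3 → ℝ),
          IsLinearizedSolution ν f T u q ∧
          u 0 ≠ 0 ∧
          (∀ t ∈ Set.Icc 0 T,
            (Real.exp (t * Real.sqrt (f * (1 - f))) - ε) * l2Norm (u 0) ≤ l2Norm (u t) ∧
            l2Norm (u t) ≤ (Real.exp (t * Real.sqrt (f * (1 - f))) + ε) * l2Norm (u 0)) ∧
          (∀ k : ℕ, 1 ≤ k → sobolevNorm k (u 0) ≤ C k * k * l2Norm (u 0)) := by
  refine ⟨fun k => 2 ^ k, fun k => by positivity, fun T ε hT hε => ?_⟩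
  have hτ : 0 < ε / 3 := by positivity
  obtain ⟨ρ₀, hρ₀, hfam⟩ := exists_isKelvinFamily hν hf0 hf1 (by linarith : 0 < T + 1) hτ
  -- the size of the box below which the spanwise components are at most `ε / 3`
  set B := (2 + (T + 1)) * (Real.exp ((T + 1) * √(f * (1 - f))) + ε / 3) *
    (1 + Real.exp ((T + 1) * √(f * (1 - f)))) with hB
  have hB0 : 0 < B := by positivity
  set ρ := min ρ₀ (min (1 / 20) (ε / 3 / B)) with hρdef
  have hρ : 0 < ρ := by positivity
  have hρB : ρ * B ≤ ε / 3 :=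
    (le_div_iff₀ hB0).1 ((min_le_right _ _).trans (min_le_right _ _))
  obtain ⟨w₁, w₂, hw⟩ := hfam ρ hρ (min_le_left _ _)
  refine ⟨_, _, hw.isLinearizedSolution hρ (by linarith : T < T + 1),
    hw.velocity_zero_ne_zero hρ hf0.le hf1.le, fun t ht => ?_, fun k hk => ?_⟩
  · have h := hw.l2Norm_bounds hρ hf0.le hf1.le hτ.le (by rw [hB] at hρB; linarith)
      (t := t) (by rw [abs_of_nonneg ht.1]; linarith [ht.2])
    rwa [mul_div_cancel₀ ε three_ne_zero] at h
  · refine (hw.sobolevNorm_velocity_zero_le hρ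
      ((min_le_right _ _).trans (min_le_left _ _)) k).trans ?_
    have hk' : (1 : ℝ) ≤ k := by exact_mod_cast hk
    exact mul_le_mul_of_nonneg_right (le_mul_of_one_le_right (by positivity) hk')
      ENNReal.toReal_nonneg
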